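/- **Conventions.** "2-category" and "2-functor" are strict. An arrow $f:X\to Y$ of a 2-category is an *equivalence* if there are an arrow $g:Y\to X$ and invertible 2-cells $id_X\Rightarrow gf$, $fg\Rightarrow id_Y$. For 2-categories $\mathscr B,\mathscr D$, $Hom_p(\mathscr B,\mathscr D)$ is the 2-category of 2-functors $\mathscr B\to\mathscr D$, pseudonatural transformations and modifications; for a class $\Sigma$ of arrows of $\mathscr B$, $Hom_p(\mathscr B,\mathscr D)_+$ is its full sub-2-category on the 2-functors which send the arrows of $\Sigma$ into equivalences. A 2-functor $F:\mathscr X\to\mathscr Y$ is a *pseudoequivalence of 2-categories* if there are a 2-functor $G:\mathscr Y\to\mathscr X$ and pseudonatural transformations $Id_{\mathscr X}\Rightarrow GF$, $FG\Rightarrow Id_{\mathscr Y}$ which are equivalences in $Hom_p(\mathscr X,\mathscr X)$ and $Hom_p(\mathscr Y,\mathscr Y)$ respectively. A category is regarded as a 2-category whose only 2-cells are identities. **The homotopy 2-category.** Let $\mathscr A$ be a category with a class $\Sigma$ of arrows. A *cylinder* for an object $X$ consists of objects $W,Z$ and arrows $d_0,d_1:X\to W$, $s:W\to Z$, $x:X\to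 Z$ with $s\in\Sigma$ and $sd_0=x=sd_1$; a *homotopy* from $f$ to $g$ ($f,g:X\to Y$) consists of a cylinder for $X$ and an arrow $h:W\to Y$ with $hd_0=f$, $hd_1=g$. If $F:\mathscr A\to\mathscr D$ is a 2-functor sending $\Sigma$ into equivalences, then for each cylinder there is a unique 2-cell $\widehat C:Fd_0\Rightarrow Fd_1$ such that $(Fs)\widehat C=id_{Fx}$; a homotopy is sent to the 2-cell $(Fh)\widehat C:Ff\Rightarrow Fg$, and a finite sequence of composable homotopies to the vertical composite (the empty sequence to an identity). $\mathcal{H}o(\mathscr A)$ is the 2-category with the objects and arrows of $\mathscr A$, whose 2-cells $f\Rightarrow g$ are the finite sequences of composable homotopies from $f$ to $g$, two sequences being identified when they are sent to the same 2-cell by every such $F$ (for every 2-category $\mathscr D$). Vertical composition is juxtaposition, and whiskering is composition of the arrows $h$, or of $d_0,d_1,x$, with an arrow of $\mathscr A$. **Theorem.** Let $\mathscr C$ be a model category (with finite limits and colimits), with chosen functorial factorizations of its arrows into a cofibration followed by a trivial fibration, and into a trivial cofibration followed by a fibration. Let $\mathcal W$ be the class of weak equivalences, and let $\mathscr C_{fc}\subseteq\mathscr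 C$ be the full subcategory of fibrant and cofibrant objects, with the class $\mathcal W\cap\mathscr C_{fc}$. Let $Q:\mathscr C\to\mathscr C$ be the functor for which $QX$ is the middle object of the first factorization of $0\to X$, let $R:\mathscr C\to\mathscr C$ be the functor for which $RX$ is the middle object of the second factorization of $X\to 1$, let $r:\mathscr C\to\mathscr C_{fc}$ be the corestriction of $RQ$, let $i':\mathscr C_{fc}\to\mathcal{H}o(\mathscr C_{fc})$ be the 2-functor which is the identity on objects and arrows, and let $q=i'r$. Then $q:\mathscr C\to\mathcal{H}o(\mathscr C_{fc})$ is the 2-localization of $\mathscr C$ at $\mathcal W$. That is, $q$ sends the arrows of $\mathcal W$ into equivalences, and, for every 2-category $\mathscr D$, the 2-functor of precomposition with $q$, $$q^*: Hom_p(\mathcal{H}o(\mathscr C_{fc}),\mathscr D)\longrightarrow Hom_p(\mathscr C,\mathscr D)_+,$$ where $+$ refers to the class $\mathcal W$, is a pseudoequivalence of 2-categories. -/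

import Mathlib

open CategoryTheory Bicategory HomotopicalAlgebra Limits
open scoped Pseudofunctor.StrongTrans

universe w₁ w₂ w₃ v₁ v₂ v₃ u₁ u₂ u₃ w' v' u' v u

namespace TwoLoc

theorem eqToHom_sandwich {A : Type u} [Category.{v} A] {X Y : A} {f g : X ⟶ Y} (e : f = g)
    (h : X = X) (k : Y = Y) : f = eqToHom h ≫ g ≫ eqToHom k := by
  subst e
  simp

theorem eqToHom_comp_eq {A : Type u} [Category.{v} A] {X Y : A} {f g : X ⟶ Y} (e : f = g)
    (h : X = X) : f = eqToHom h ≫ g := by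
  subst e
  simp

/-! ### Equivalences in a 2-category -/

section Equivalences

variable {B : Type u₁} [Bicategory.{w₁, v₁} B] {D : Type u₂} [Bicategory.{w₂, v₂} D]

/-- An arrow of a 2-category is an equivalence if it has a quasi-inverse. -/
def IsEquiv {X Y : B} (f : X ⟶ Y) : Prop :=
  ∃ g : Y ⟶ X, Nonempty (𝟙 X ≅ f ≫ g) ∧ Nonempty (g ≫ f ≅ 𝟙 Y)

/-- The 2-functor `F` sends the arrows of the class `S` into equivalences. -/
def Inverts (F : StrictPseudofunctor B D) (S : MorphismProperty B) : Prop :=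
  ∀ ⦃X Y : B⦄ (f : X ⟶ Y), S f → IsEquiv (F.map f)

theorem IsEquiv.map (F : StrictPseudofunctor B D) {X Y : B} {f : X ⟶ Y} (hf : IsEquiv f) :
    IsEquiv (F.map f) := by
  obtain ⟨g, ⟨η⟩, ⟨δ⟩⟩ := hf
  exact ⟨F.map g,
    ⟨(F.mapId X).symm ≪≫ F.map₂Iso η ≪≫ F.mapComp f g⟩,
    ⟨(F.mapComp g f).symm ≪≫ F.map₂Iso δ ≪≫ F.mapId Y⟩⟩

/-- Composing with an equivalence is an equivalence of hom-categories. -/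
def postcompEquivalence {X Y : B} {f : X ⟶ Y} {g : Y ⟶ X} (η : 𝟙 X ≅ f ≫ g)
    (δ : g ≫ f ≅ 𝟙 Y) (Z : B) : (Z ⟶ X) ≌ (Z ⟶ Y) :=
  CategoryTheory.Equivalence.mk (postcomp Z f) (postcomp Z g)
    (NatIso.ofComponents (fun h => (ρ_ h).symm ≪≫ whiskerLeftIso h η ≪≫ (α_ h f g).symm)
      (by
        intro h k α
        simp only [Functor.id_obj, Functor.id_map, Functor.comp_obj, Functor.comp_map, postcomp,
          Iso.trans_hom, Iso.symm_hom, whiskerLeftIso_hom, Category.assoc]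
        rw [rightUnitor_inv_naturality_assoc, ← whisker_exchange_assoc,
          associator_inv_naturality_left]))
    (NatIso.ofComponents (fun h => α_ h g f ≪≫ whiskerLeftIso h δ ≪≫ ρ_ h)
      (by
        intro h k α
        simp only [Functor.id_obj, Functor.id_map, Functor.comp_obj, Functor.comp_map, postcomp,
          Iso.trans_hom, whiskerLeftIso_hom, Category.assoc]
        rw [associator_naturality_left_assoc, ← whisker_exchange_assoc, rightUnitor_naturality]))

theorem IsEquiv.existsUnique {X Y Z : B} {s : X ⟶ Y} (hs : IsEquiv s) {f g : Z ⟶ X}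
    (β : f ≫ s ⟶ g ≫ s) : ∃! α : f ⟶ g, α ▷ s = β := by
  obtain ⟨t, ⟨η⟩, ⟨δ⟩⟩ := hs
  exact (postcompEquivalence η δ Z).fullyFaithfulFunctor.map_bijective f g |>.existsUnique β

end Equivalences

/-! ### The homotopy 2-category of a category with a class of arrows -/

section Homotopies

variable {A : Type u} [Category.{v} A] (W : MorphismProperty A)

/-- A cylinder for `X`: arrows `d₀, d₁ : X ⟶ cyl`, `s : cyl ⟶ base` in `W` and `x : X ⟶ base`
such that `s d₀ = x = s d₁`. -/
structure Cylinder (X : A) where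
  cyl : A
  base : A
  d₀ : X ⟶ cyl
  d₁ : X ⟶ cyl
  s : cyl ⟶ base
  x : X ⟶ base
  hs : W s
  fac₀ : d₀ ≫ s = x
  fac₁ : d₁ ≫ s = x

/-- A (left) homotopy from `f` to `g`. -/
structure Homotopy {X Y : A} (f g : X ⟶ Y) where
  C : Cylinder W X
  h : C.cyl ⟶ Y
  fac₀ : C.d₀ ≫ h = f
  fac₁ : C.d₁ ≫ h = g

/-- Finite sequences of composable homotopies. -/
inductive HomotopySeq {X Y : A} : (X ⟶ Y) → (X ⟶ Y) → Type (max u v)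
  | nil (f : X ⟶ Y) : HomotopySeq f f
  | cons {f g h : X ⟶ Y} (H : Homotopy W f g) (K : HomotopySeq g h) : HomotopySeq f h

variable {W}

section Operations

variable {X' X Y Y' : A}

/-- The cylinder obtained by composing `d₀`, `d₁` and `x` with `l`. -/
abbrev Cylinder.precomp (C : Cylinder W X) (l : X' ⟶ X) : Cylinder W X' where
  cyl := C.cyl
  base := C.base
  d₀ := l ≫ C.d₀
  d₁ := l ≫ C.d₁
  s := C.s
  x := l ≫ C.x
  hs := C.hs
  fac₀ := by rw [Category.assoc, C.fac₀]
  fac₁ := by rw [Category.assoc, C.fac₁]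

/-- The composite of a homotopy with an arrow `l` into its domain. -/
abbrev Homotopy.precomp (l : X' ⟶ X) {f g : X ⟶ Y} (H : Homotopy W f g) :
    Homotopy W (l ≫ f) (l ≫ g) where
  C := H.C.precomp l
  h := H.h
  fac₀ := by simp only [Cylinder.precomp, Category.assoc, H.fac₀]
  fac₁ := by simp only [Cylinder.precomp, Category.assoc, H.fac₁]

/-- The composite of a homotopy with an arrow `r` out of its codomain. -/
abbrev Homotopy.postcomp {f g : X ⟶ Y} (H : Homotopy W f g) (r : Y ⟶ Y') :
    Homotopy W (f ≫ r) (g ≫ r) where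
  C := H.C
  h := H.h ≫ r
  fac₀ := by rw [← Category.assoc, H.fac₀]
  fac₁ := by rw [← Category.assoc, H.fac₁]

/-- Juxtaposition of sequences of homotopies. -/
def HomotopySeq.append : {f g h : X ⟶ Y} → HomotopySeq W f g → HomotopySeq W g h →
    HomotopySeq W f h
  | _, _, _, .nil _, L => L
  | _, _, _, .cons H K, L => .cons H (K.append L)

/-- Composing all the homotopies of a sequence with `l`. -/
def HomotopySeq.precomp (l : X' ⟶ X) : {f g : X ⟶ Y} → HomotopySeq W f g →
    HomotopySeq W (l ≫ f) (l ≫ g)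
  | _, _, .nil f => .nil (l ≫ f)
  | _, _, .cons H K => .cons (H.precomp l) (K.precomp l)

/-- Composing all the homotopies of a sequence with `r`. -/
def HomotopySeq.postcomp (r : Y ⟶ Y') : {f g : X ⟶ Y} → HomotopySeq W f g →
    HomotopySeq W (f ≫ r) (g ≫ r)
  | _, _, .nil f => .nil (f ≫ r)
  | _, _, .cons H K => .cons (H.postcomp r) (K.postcomp r)

end Operations

/-- The class `W` of arrows of a category, seen as a class of arrows of the 2-category whose only
2-cells are identities. -/
def toLoc (W : MorphismProperty A) : MorphismProperty (LocallyDiscrete A) :=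
  fun _ _ f => W f.as

section Hat

variable {D : Type u'} [Bicategory.{w', v'} D] (F : StrictPseudofunctor (LocallyDiscrete A) D)
  (hF : Inverts F (toLoc W))

/-- The value of `F` at an arrow of `A`. -/
def onArrow {X Y : A} (f : X ⟶ Y) : F.obj ⟨X⟩ ⟶ F.obj ⟨Y⟩ := F.map f.toLoc

theorem onArrow_eq {X Y Z : A} {f : X ⟶ Y} {g : Y ⟶ Z} {k : X ⟶ Z} (h : f ≫ g = k) :
    onArrow F f ≫ onArrow F g = onArrow F k := by
  subst h
  exact (F.map_comp f.toLoc g.toLoc).symm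

theorem onArrow_id (X : A) : onArrow F (𝟙 X) = 𝟙 (F.obj ⟨X⟩) := F.map_id ⟨X⟩

theorem hatCylinder_existsUnique (hF : Inverts F (toLoc W)) {X : A} (C : Cylinder W X) :
    ∃! α : onArrow F C.d₀ ⟶ onArrow F C.d₁,
      α ▷ onArrow F C.s =
        eqToHom ((onArrow_eq F C.fac₀).trans (onArrow_eq F C.fac₁).symm) :=
  (hF C.s.toLoc C.hs).existsUnique _

/-- The unique 2-cell `F d₀ ⟶ F d₁` whose composite with `F s` is the identity of `F x`. -/
noncomputable def hatCylinder {X : A} (C : Cylinder W X) :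
    onArrow F C.d₀ ⟶ onArrow F C.d₁ :=
  (hatCylinder_existsUnique F hF C).choose

/-- The 2-cell `F f ⟶ F g` associated to a homotopy from `f` to `g`: the composite of
`hatCylinder` with `F h`. -/
noncomputable def hat {X Y : A} {f g : X ⟶ Y} (H : Homotopy W f g) :
    onArrow F f ⟶ onArrow F g :=
  eqToHom (onArrow_eq F H.fac₀).symm ≫ hatCylinder F hF H.C ▷ onArrow F H.h ≫
    eqToHom (onArrow_eq F H.fac₁)

/-- The vertical composite of the 2-cells associated to a sequence of homotopies. -/
noncomputable def hatSeq {X Y : A} : {f g : X ⟶ Y} → HomotopySeq W f g →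
    (onArrow F f ⟶ onArrow F g)
  | _, _, .nil _ => 𝟙 _
  | _, _, .cons H K => hat F hF H ≫ hatSeq K

theorem hatCylinder_spec {X : A} (C : Cylinder W X) :
    hatCylinder F hF C ▷ onArrow F C.s =
        eqToHom ((onArrow_eq F C.fac₀).trans (onArrow_eq F C.fac₁).symm) :=
  (hatCylinder_existsUnique F hF C).choose_spec.1

theorem hatCylinder_unique {X : A} (C : Cylinder W X) (α : onArrow F C.d₀ ⟶ onArrow F C.d₁)
    (hα : α ▷ onArrow F C.s =
        eqToHom ((onArrow_eq F C.fac₀).trans (onArrow_eq F C.fac₁).symm)) :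
    α = hatCylinder F hF C :=
  (hatCylinder_existsUnique F hF C).choose_spec.2 α hα

theorem hatSeq_append {X Y : A} {f g h : X ⟶ Y} (K : HomotopySeq W f g)
    (L : HomotopySeq W g h) : hatSeq F hF (K.append L) = hatSeq F hF K ≫ hatSeq F hF L := by
  induction K with
  | nil f => simp [HomotopySeq.append, hatSeq]
  | cons H K ih => simp [HomotopySeq.append, hatSeq, ih]

variable [Strict D]

theorem hatCylinder_precomp {X' X : A} (l : X' ⟶ X) (C : Cylinder W X) :
    hatCylinder F hF (C.precomp l) =
      eqToHom (onArrow_eq F rfl).symm ≫ onArrow F l ◁ hatCylinder F hF C ≫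
        eqToHom (onArrow_eq F rfl) := by
  symm
  refine hatCylinder_unique F hF (C.precomp l) _ ?_
  have h := hatCylinder_spec F hF C
  simp only [comp_whiskerRight, whisker_assoc, eqToHom_whiskerRight]
  change _ ≫ ((α_ _ _ _).hom ≫ _ ◁ (hatCylinder F hF C ▷ onArrow F C.s) ≫ (α_ _ _ _).inv) ≫ _ = _
  rw [h]
  simp [Strict.associator_eqToIso]

theorem hat_precomp {X' X Y : A} (l : X' ⟶ X) {f g : X ⟶ Y} (H : Homotopy W f g) :
    hat F hF (H.precomp l) =
      eqToHom (onArrow_eq F rfl).symm ≫ onArrow F l ◁ hat F hF H ≫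
        eqToHom (onArrow_eq F rfl) := by
  simp only [hat]
  change _ ≫ (hatCylinder F hF (H.C.precomp l)) ▷ onArrow F H.h ≫ _ = _
  rw [hatCylinder_precomp]
  simp only [comp_whiskerRight, whisker_assoc, eqToHom_whiskerRight]
  simp [Strict.associator_eqToIso]

theorem hat_postcomp {X Y Y' : A} {f g : X ⟶ Y} (H : Homotopy W f g) (r : Y ⟶ Y') :
    hat F hF (H.postcomp r) =
      eqToHom (onArrow_eq F rfl).symm ≫ hat F hF H ▷ onArrow F r ≫
        eqToHom (onArrow_eq F rfl) := by
  simp only [hat]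
  change _ ≫ hatCylinder F hF H.C ▷ onArrow F (H.h ≫ r) ≫ _ = _
  rw [whiskerRight_congr (onArrow_eq F (rfl : H.h ≫ r = H.h ≫ r)).symm]
  simp [Strict.associator_eqToIso]

theorem hatSeq_precomp {X' X Y : A} (l : X' ⟶ X) {f g : X ⟶ Y} (K : HomotopySeq W f g) :
    hatSeq F hF (K.precomp l) =
      eqToHom (onArrow_eq F rfl).symm ≫ onArrow F l ◁ hatSeq F hF K ≫
        eqToHom (onArrow_eq F rfl) := by
  induction K with
  | nil f => simp [HomotopySeq.precomp, hatSeq]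
  | cons H K ih => simp [HomotopySeq.precomp, hatSeq, ih, hat_precomp]

theorem hatSeq_postcomp {X Y Y' : A} (r : Y ⟶ Y') {f g : X ⟶ Y} (K : HomotopySeq W f g) :
    hatSeq F hF (K.postcomp r) =
      eqToHom (onArrow_eq F rfl).symm ≫ hatSeq F hF K ▷ onArrow F r ≫
        eqToHom (onArrow_eq F rfl) := by
  induction K with
  | nil f => simp [HomotopySeq.postcomp, hatSeq]
  | cons H K ih => simp [HomotopySeq.postcomp, hatSeq, ih, hat_postcomp]

end Hat

set_option linter.checkUnivs false in
/-- A 2-functor from `A` (as a 2-category whose only 2-cells are identities) to some 2-category, which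
sends the arrows of `W` into equivalences. -/
structure InvertingFunctor (W : MorphismProperty A) where
  D : Type u'
  [bicategory : Bicategory.{w', v'} D]
  [strict : Strict D]
  F : StrictPseudofunctor (LocallyDiscrete A) D
  inverts : Inverts F (toLoc W)

attribute [instance] InvertingFunctor.bicategory InvertingFunctor.strict

variable (T : Set (InvertingFunctor.{w', v', u'} W))

/-- Two sequences of homotopies are identified when the associated 2-cells coincide, for every
2-functor in `T`. The ad-hoc relation is the one where `T` consists of all the 2-functors which
send the arrows of `W` into equivalences. -/
def seqSetoid {X Y : A} (f g : X ⟶ Y) : Setoid (HomotopySeq W f g) where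
  r K L := ∀ P ∈ T, hatSeq P.F P.inverts K = hatSeq P.F P.inverts L
  iseqv :=
    ⟨fun _ _ _ => rfl, fun h P hP => (h P hP).symm, fun h k P hP => (h P hP).trans (k P hP)⟩

variable {T} in
theorem hatSeq_eq_of_rel {X Y : A} {f g : X ⟶ Y} {K L : HomotopySeq W f g}
    (h : seqSetoid T f g K L) (P : InvertingFunctor.{w', v', u'} W) (hP : P ∈ T) :
    hatSeq P.F P.inverts K = hatSeq P.F P.inverts L := h P hP

/-- The 2-cells of the homotopy 2-category. -/
def TwoCell {X Y : A} (f g : X ⟶ Y) : Type (max u v) :=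
  Quotient (seqSetoid T f g)

namespace TwoCell

variable {X' X Y Y' : A} {T}

variable (T) in
/-- The class of the empty sequence. -/
def id (f : X ⟶ Y) : TwoCell T f f := Quotient.mk _ (.nil f)

/-- Vertical composition: juxtaposition of sequences. -/
def comp {f g h : X ⟶ Y} (α : TwoCell T f g) (β : TwoCell T g h) :
    TwoCell T f h :=
  Quotient.map₂ HomotopySeq.append (fun K K' hK L L' hL P hP => by
    rw [hatSeq_append, hatSeq_append, hK P hP, hL P hP]) α β

/-- Whiskering with an arrow `l` into the domain. -/
def precomp (l : X' ⟶ X) {f g : X ⟶ Y} (α : TwoCell T f g) :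
    TwoCell T (l ≫ f) (l ≫ g) :=
  Quotient.map (HomotopySeq.precomp l) (fun K L h P hP => by
    rw [hatSeq_precomp, hatSeq_precomp, h P hP]) α

/-- Whiskering with an arrow `r` out of the codomain. -/
def postcomp {f g : X ⟶ Y} (α : TwoCell T f g) (r : Y ⟶ Y') :
    TwoCell T (f ≫ r) (g ≫ r) :=
  Quotient.map (HomotopySeq.postcomp r) (fun K L h P hP => by
    rw [hatSeq_postcomp, hatSeq_postcomp, h P hP]) α

section Eval

variable (P : InvertingFunctor.{w', v', u'} W) (hP : P ∈ T)

/-- The value of `F` at a 2-cell of the homotopy 2-category. -/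
noncomputable def eval {f g : X ⟶ Y} (α : TwoCell T f g) :
    onArrow P.F f ⟶ onArrow P.F g :=
  Quotient.lift (hatSeq P.F P.inverts) (fun _ _ h => hatSeq_eq_of_rel h P hP) α

theorem eval_id (f : X ⟶ Y) : eval P hP (TwoCell.id T f) = 𝟙 _ := rfl

theorem eval_comp {f g h : X ⟶ Y} (α : TwoCell T f g)
    (β : TwoCell T g h) : eval P hP (α.comp β) = eval P hP α ≫ eval P hP β := by
  induction α using Quotient.inductionOn
  induction β using Quotient.inductionOn
  exact hatSeq_append P.F P.inverts _ _

theorem eval_precomp (l : X' ⟶ X) {f g : X ⟶ Y} (α : TwoCell T f g) :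
    eval P hP (α.precomp l) =
      eqToHom (onArrow_eq P.F rfl).symm ≫ onArrow P.F l ◁ eval P hP α ≫
        eqToHom (onArrow_eq P.F rfl) := by
  induction α using Quotient.inductionOn
  exact hatSeq_precomp P.F P.inverts _ _

theorem eval_postcomp {f g : X ⟶ Y} (α : TwoCell T f g) (r : Y ⟶ Y') :
    eval P hP (α.postcomp r) =
      eqToHom (onArrow_eq P.F rfl).symm ≫ eval P hP α ▷ onArrow P.F r ≫
        eqToHom (onArrow_eq P.F rfl) := by
  induction α using Quotient.inductionOn
  exact hatSeq_postcomp P.F P.inverts _ _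

end Eval

theorem ext {f g : X ⟶ Y} {α β : TwoCell T f g}
    (h : ∀ (P : InvertingFunctor.{w', v', u'} W) (hP : P ∈ T),
      eval P hP α = eval P hP β) : α = β := by
  induction α using Quotient.inductionOn
  induction β using Quotient.inductionOn
  exact Quotient.sound fun P hP => h P hP

end TwoCell

/-- The objects of the homotopy 2-category of `A` at `W`: the objects of `A`. -/
@[nolint unusedArguments]
structure HoCat (T : Set (InvertingFunctor.{w', v', u'} W)) : Type u where
  as : A

namespace HoCat

variable {T}

/-- The arrows of the homotopy 2-category: the arrows of `A`. -/
@[ext]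
structure Hom {T : Set (InvertingFunctor.{w', v', u'} W)} (X Y : HoCat T) : Type v where
  as : X.as ⟶ Y.as

instance : CategoryStruct (HoCat T) where
  Hom X Y := Hom X Y
  id X := ⟨𝟙 X.as⟩
  comp f g := ⟨f.as ≫ g.as⟩

instance (X Y : HoCat T) : Category (X ⟶ Y) where
  Hom f g := TwoCell T f.as g.as
  id f := TwoCell.id T f.as
  comp α β := TwoCell.comp α β
  id_comp α := TwoCell.ext fun P hP => by
    rw [TwoCell.eval_comp, TwoCell.eval_id, Category.id_comp]
  comp_id α := TwoCell.ext fun P hP => by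
    rw [TwoCell.eval_comp, TwoCell.eval_id, Category.comp_id]
  assoc α β γ := TwoCell.ext fun P hP => by
    rw [TwoCell.eval_comp, TwoCell.eval_comp, TwoCell.eval_comp, TwoCell.eval_comp,
      Category.assoc]

section Eval

variable (P : InvertingFunctor.{w', v', u'} W) (hP : P ∈ T)

/-- `TwoCell.eval`, on the 2-cells of `HoCat T`. -/
noncomputable def ev {X Y : HoCat T} {f g : X ⟶ Y} (α : f ⟶ g) :
    onArrow P.F f.as ⟶ onArrow P.F g.as := TwoCell.eval P hP α

theorem ev_id {X Y : HoCat T} (f : X ⟶ Y) : ev P hP (𝟙 f) = 𝟙 _ := rfl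

theorem ev_comp {X Y : HoCat T} {f g h : X ⟶ Y} (α : f ⟶ g) (β : g ⟶ h) :
    ev P hP (α ≫ β) = ev P hP α ≫ ev P hP β := TwoCell.eval_comp P hP α β

theorem ev_eqToHom {X Y : HoCat T} {f g : X ⟶ Y} (h : f = g) :
    ev P hP (eqToHom h) = eqToHom (by rw [h]) := by
  subst h
  rfl

end Eval

theorem hom₂_ext {X Y : HoCat T} {f g : X ⟶ Y} {α β : f ⟶ g}
    (h : ∀ (P : InvertingFunctor.{w', v', u'} W) (hP : P ∈ T),
      ev P hP α = ev P hP β) : α = β := TwoCell.ext h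

/-- Left whiskering in `HoCat T`. -/
def wL {X Y Z : HoCat T} (l : X ⟶ Y) {f g : Y ⟶ Z} (α : f ⟶ g) :
    l ≫ f ⟶ l ≫ g := TwoCell.precomp l.as α

/-- Right whiskering in `HoCat T`. -/
def wR {X Y Z : HoCat T} {f g : X ⟶ Y} (α : f ⟶ g) (r : Y ⟶ Z) :
    f ≫ r ⟶ g ≫ r := TwoCell.postcomp α r.as

theorem comp_eq {X Y Z : HoCat T} (f : X ⟶ Y) (g : Y ⟶ Z) :
    (f ≫ g).as = f.as ≫ g.as := rfl

theorem id_eq (X : HoCat T) : Hom.as (𝟙 X) = 𝟙 X.as := rfl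

section Eval

variable (P : InvertingFunctor.{w', v', u'} W) (hP : P ∈ T)

theorem ev_wL {X Y Z : HoCat T} (l : X ⟶ Y) {f g : Y ⟶ Z} (α : f ⟶ g) :
    ev P hP (wL l α) = eqToHom (onArrow_eq P.F rfl).symm ≫ onArrow P.F l.as ◁ ev P hP α ≫
        eqToHom (onArrow_eq P.F rfl) := TwoCell.eval_precomp P hP l.as α

theorem ev_wR {X Y Z : HoCat T} {f g : X ⟶ Y} (α : f ⟶ g) (r : Y ⟶ Z) :
    ev P hP (wR α r) = eqToHom (onArrow_eq P.F rfl).symm ≫ ev P hP α ▷ onArrow P.F r.as ≫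
        eqToHom (onArrow_eq P.F rfl) := TwoCell.eval_postcomp P hP α r.as

end Eval

theorem hassoc {X Y Z T : HoCat T} (f : X ⟶ Y) (g : Y ⟶ Z) (h : Z ⟶ T) :
    (f ≫ g) ≫ h = f ≫ g ≫ h := Hom.ext (Category.assoc _ _ _)

theorem hid_comp {X Y : HoCat T} (f : X ⟶ Y) : 𝟙 X ≫ f = f :=
  Hom.ext (Category.id_comp _)

theorem hcomp_id {X Y : HoCat T} (f : X ⟶ Y) : f ≫ 𝟙 Y = f :=
  Hom.ext (Category.comp_id _)

section Laws

variable {X Y Z V : HoCat T}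

theorem whiskerLeft_eq_of_eq {D : Type u'} [Bicategory.{w', v'} D] {a b c : D}
    {f f' : a ⟶ b} (e : f = f') {g h : b ⟶ c} (η : g ⟶ h) :
    f ◁ η = eqToHom (by rw [e]) ≫ f' ◁ η ≫ eqToHom (by rw [e]) := by
  subst e
  simp

theorem whiskerRight_eq_of_eq {D : Type u'} [Bicategory.{w', v'} D] {a b c : D}
    {f f' : b ⟶ c} (e : f = f') {g h : a ⟶ b} (η : g ⟶ h) :
    η ▷ f = eqToHom (by rw [e]) ≫ η ▷ f' ≫ eqToHom (by rw [e]) := by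
  subst e
  simp

theorem wL_id (f : X ⟶ Y) (g : Y ⟶ Z) : wL f (𝟙 g) = 𝟙 (f ≫ g) :=
  hom₂_ext fun P hP => by
    simp [ev_wL, ev_id]
    rfl

theorem wL_comp (f : X ⟶ Y) {g h i : Y ⟶ Z} (η : g ⟶ h) (θ : h ⟶ i) :
    wL f (η ≫ θ) = wL f η ≫ wL f θ :=
  hom₂_ext fun P hP => by simp [ev_wL, ev_comp]

theorem id_wL {f g : X ⟶ Y} (η : f ⟶ g) :
    wL (𝟙 X) η = eqToHom (hid_comp f) ≫ η ≫ eqToHom (hid_comp g).symm :=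
  hom₂_ext fun P hP => by
    rw [ev_wL, whiskerLeft_eq_of_eq ((congrArg _ (id_eq X)).trans (onArrow_id P.F X.as))]
    simp [ev_comp, ev_eqToHom, Strict.leftUnitor_eqToIso]

theorem comp_wL (f : X ⟶ Y) (g : Y ⟶ Z) {h h' : Z ⟶ V} (η : h ⟶ h') :
    wL (f ≫ g) η = eqToHom (hassoc f g h) ≫ wL f (wL g η) ≫ eqToHom (hassoc f g h').symm :=
  hom₂_ext fun P hP => by
    rw [ev_wL, whiskerLeft_eq_of_eq (onArrow_eq P.F (comp_eq f g).symm).symm]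
    simp [ev_wL, ev_comp, ev_eqToHom, Strict.associator_eqToIso]

theorem id_wR (f : X ⟶ Y) (g : Y ⟶ Z) : wR (𝟙 f) g = 𝟙 (f ≫ g) :=
  hom₂_ext fun P hP => by
    simp [ev_wR, ev_id]
    rfl

theorem comp_wR {f g h : X ⟶ Y} (η : f ⟶ g) (θ : g ⟶ h) (i : Y ⟶ Z) :
    wR (η ≫ θ) i = wR η i ≫ wR θ i :=
  hom₂_ext fun P hP => by simp [ev_wR, ev_comp]

theorem wR_id {f g : X ⟶ Y} (η : f ⟶ g) :
    wR η (𝟙 Y) = eqToHom (hcomp_id f) ≫ η ≫ eqToHom (hcomp_id g).symm :=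
  hom₂_ext fun P hP => by
    rw [ev_wR, whiskerRight_eq_of_eq ((congrArg _ (id_eq Y)).trans (onArrow_id P.F Y.as))]
    simp [ev_comp, ev_eqToHom, Strict.rightUnitor_eqToIso]

theorem wR_comp {f f' : X ⟶ Y} (η : f ⟶ f') (g : Y ⟶ Z) (h : Z ⟶ V) :
    wR η (g ≫ h) = eqToHom (hassoc f g h).symm ≫ wR (wR η g) h ≫ eqToHom (hassoc f' g h) :=
  hom₂_ext fun P hP => by
    rw [ev_wR, whiskerRight_eq_of_eq (onArrow_eq P.F (comp_eq g h).symm).symm]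
    simp [ev_wR, ev_comp, ev_eqToHom, Strict.associator_eqToIso]

theorem w_assoc (f : X ⟶ Y) {g g' : Y ⟶ Z} (η : g ⟶ g') (h : Z ⟶ V) :
    wR (wL f η) h = eqToHom (hassoc f g h) ≫ wL f (wR η h) ≫ eqToHom (hassoc f g' h).symm :=
  hom₂_ext fun P hP => by
    simp [ev_wR, ev_wL, ev_comp, ev_eqToHom, Strict.associator_eqToIso]

theorem w_exchange {f g : X ⟶ Y} {h i : Y ⟶ Z} (η : f ⟶ g) (θ : h ⟶ i) :
    wL f θ ≫ wR η i = wR η h ≫ wL g θ :=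
  hom₂_ext fun P hP => by
    simp [ev_wR, ev_wL, ev_comp, whisker_exchange_assoc]

theorem wL_eqToHom (f : X ⟶ Y) {g h : Y ⟶ Z} (e : g = h) :
    wL f (eqToHom e) = eqToHom (by rw [e]) := by
  subst e
  exact wL_id _ _

theorem wR_eqToHom {f g : X ⟶ Y} (e : f = g) (h : Y ⟶ Z) :
    wR (eqToHom e) h = eqToHom (by rw [e]) := by
  subst e
  exact id_wR _ _

end Laws

/-- The homotopy 2-category: its 2-cells are the classes of sequences of homotopies. -/
instance : Bicategory (HoCat T) where
  whiskerLeft l _ _ α := wL l α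
  whiskerRight α r := wR α r
  associator f g h := eqToIso (hassoc f g h)
  leftUnitor f := eqToIso (hid_comp f)
  rightUnitor f := eqToIso (hcomp_id f)
  whiskerLeft_id := wL_id
  whiskerLeft_comp f _ _ _ η θ := wL_comp f η θ
  id_whiskerLeft := id_wL
  comp_whiskerLeft f g _ _ η := comp_wL f g η
  id_whiskerRight := id_wR
  comp_whiskerRight := comp_wR
  whiskerRight_id := wR_id
  whiskerRight_comp := wR_comp
  whisker_assoc f _ _ η h := w_assoc f η h
  whisker_exchange := w_exchange
  pentagon f g h i := by
    simp only [eqToIso.hom, wL_eqToHom, wR_eqToHom, eqToHom_trans]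
  triangle f g := by
    simp only [eqToIso.hom, wL_eqToHom, wR_eqToHom, eqToHom_trans]

instance : Strict (HoCat T) where
  id_comp := hid_comp
  comp_id := hcomp_id
  assoc := hassoc

theorem eq_wL_eqToHom {X Y Z : HoCat T} (f : X ⟶ Y) {g h : Y ⟶ Z} (e : g = h)
    {k l : X ⟶ Z} (p : k = l) (q : k = f ≫ g) (r : f ≫ h = l) :
    eqToHom p = eqToHom q ≫ f ◁ eqToHom e ≫ eqToHom r := by
  subst e q r
  simp

theorem eq_wR_eqToHom {X Y Z : HoCat T} {f g : X ⟶ Y} (e : f = g) (h : Y ⟶ Z)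
    {k l : X ⟶ Z} (p : k = l) (q : k = f ≫ h) (r : g ≫ h = l) :
    eqToHom p = eqToHom q ≫ eqToHom e ▷ h ≫ eqToHom r := by
  subst e q r
  simp

/-- The 2-functor from `A` to its homotopy 2-category which is the identity on objects and on
arrows. -/
def incl (T : Set (InvertingFunctor.{w', v', u'} W)) :
    StrictPseudofunctor (LocallyDiscrete A) (HoCat T) :=
  StrictPseudofunctor.mk''
    { obj := fun X => ⟨X.as⟩
      map := fun f => ⟨f.as⟩
      map₂ := fun η => eqToHom (by rw [LocallyDiscrete.eq_of_hom η])
      map₂_id := fun _ => rfl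
      map₂_comp := fun _ _ => (eqToHom_trans _ _).symm
      map_id := fun _ => rfl
      map_comp := fun _ _ => rfl
      map₂_whisker_left := fun _ _ _ _ => eq_wL_eqToHom _ _ _ _ _
      map₂_whisker_right := fun _ _ => eq_wR_eqToHom _ _ _ _ _ }

end HoCat

end Homotopies

/-- A functor, as a 2-functor between 2-categories whose only 2-cells are identities. -/
def functorToStrict {A : Type u₁} [Category.{v₁} A] {B : Type u₂} [Category.{v₂} B]
    (F : A ⥤ B) : StrictPseudofunctor (LocallyDiscrete A) (LocallyDiscrete B) :=
  StrictPseudofunctor.mk''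
    { obj := fun X => ⟨F.obj X.as⟩
      map := fun f => (F.map f.as).toLoc
      map₂ := fun η => eqToHom (by rw [LocallyDiscrete.eq_of_hom η])
      map_id := fun X => congrArg Quiver.Hom.toLoc (F.map_id X.as)
      map_comp := fun f g => congrArg Quiver.Hom.toLoc (F.map_comp f.as g.as)
      map₂_whisker_left := fun _ _ _ _ => Subsingleton.elim _ _
      map₂_whisker_right := fun _ _ => Subsingleton.elim _ _ }

/-! ### 2-categories of 2-functors -/

section HomP

variable (B : Type u₁) [Bicategory.{w₁, v₁} B] (D : Type u₂) [Bicategory.{w₂, v₂} D]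

/-- The 2-category of 2-functors, pseudonatural transformations and modifications. -/
abbrev HomP :=
  InducedBicategory (Pseudofunctor B D) (fun F : StrictPseudofunctor B D => F.toPseudofunctor)

variable {B} in
/-- The full sub-2-category of `HomP B D` on the 2-functors which send the arrows of `S` into
equivalences. -/
abbrev HomPPlus (S : MorphismProperty B) :=
  InducedBicategory (Pseudofunctor B D)
    (fun F : {F : StrictPseudofunctor B D // Inverts F S} => F.1.toPseudofunctor)

end HomP

section Precomp

variable {B : Type u₁} [Bicategory.{w₁, v₁} B] {E : Type u₂} [Bicategory.{w₂, v₂} E]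
  {D : Type u₃} [Bicategory.{w₃, v₃} D] 

theorem Inverts.comp {S : MorphismProperty B} {q : StrictPseudofunctor B E} (hq : Inverts q S)
    (F : StrictPseudofunctor E D) : Inverts (q.comp F) S :=
  fun _ _ f hf => (hq f hf).map F

theorem square_comp {a b c d : D} {s s' s'' : a ⟶ b} {t t' t'' : c ⟶ d} {k : a ⟶ c} {l : b ⟶ d}
    {x : s ⟶ s'} {x' : s' ⟶ s''} {y : t ⟶ t'} {y' : t' ⟶ t''} {m : s ≫ l ⟶ k ≫ t}
    {m' : s' ≫ l ⟶ k ≫ t'} {z : s'' ≫ l ⟶ k ≫ t''} (h : x ▷ l ≫ m' = m ≫ k ◁ y)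
    (h' : m' ≫ k ◁ y' = x' ▷ l ≫ z) : m ≫ k ◁ (y ≫ y') = (x ≫ x') ▷ l ≫ z := by
  rw [whiskerLeft_comp, comp_whiskerRight, Category.assoc, ← h', reassoc_of% h]

/-- The pseudonatural transformation `α q : F q ⟹ G q`. -/
def whiskerTrans (q : StrictPseudofunctor B E) {F G : StrictPseudofunctor E D}
    (α : F.toPseudofunctor ⟶ G.toPseudofunctor) :
    (q.comp F).toPseudofunctor ⟶ (q.comp G).toPseudofunctor where
  app a := α.app (q.obj a)
  naturality f := α.naturality (q.map f)
  naturality_naturality η := α.naturality_naturality (q.map₂ η)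
  naturality_id a :=
    square_comp (α.naturality_naturality (q.mapId a).hom) (α.naturality_id (q.obj a))
  naturality_comp f g :=
    square_comp (α.naturality_naturality (q.mapComp f g).hom)
      (α.naturality_comp (q.map f) (q.map g))

/-- The modification `m q : α q ⟶ β q`. -/
def whiskerMod (q : StrictPseudofunctor B E) {F G : StrictPseudofunctor E D}
    {α β : F.toPseudofunctor ⟶ G.toPseudofunctor} (m : α ⟶ β) :
    whiskerTrans q α ⟶ whiskerTrans q β where
  as := 
    { app := fun a => m.as.app (q.obj a)
      naturality := fun f => m.as.naturality (q.map f) }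

/-- The 2-functor `F ∘ q`, which sends the arrows of `S` into equivalences. -/
def precomposeObj {S : MorphismProperty B} (q : StrictPseudofunctor B E) (hq : Inverts q S)
    (D : Type u₃) [Bicategory.{w₃, v₃} D] (F : HomP E D) : HomPPlus D S :=
  ⟨q.comp F, hq.comp F⟩

/-- Precomposition with a 2-functor `q` which sends the arrows of `S` into equivalences. -/
def precompose {S : MorphismProperty B} (q : StrictPseudofunctor B E) (hq : Inverts q S)
    (D : Type u₃) [Bicategory.{w₃, v₃} D] :
    StrictPseudofunctor (HomP E D) (HomPPlus D S) :=
  StrictPseudofunctor.mk'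
    { obj := precomposeObj q hq D
      map := fun α => InducedBicategory.mkHom (whiskerTrans q α.hom)
      map₂ := fun m => InducedBicategory.mkHom₂ (whiskerMod q m.hom)
      map_id := fun F => rfl
      map_comp := fun α β => rfl
      map₂_whisker_left := fun f _ _ η => eqToHom_sandwich rfl _ _
      map₂_whisker_right := fun η g => eqToHom_sandwich rfl _ _
      map₂_left_unitor := fun f => eqToHom_comp_eq rfl _
      map₂_right_unitor := fun f => eqToHom_comp_eq rfl _
      map₂_associator := fun f g h => eqToHom_sandwich rfl _ _ }

end Precomp

/-! ### Pseudoequivalences and 2-localizations -/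

section Localization

/-- A 2-functor `F` is a pseudoequivalence of 2-categories if there are a 2-functor `G` in the
opposite direction and pseudonatural transformations `Id ⟹ G F` and `F G ⟹ Id` which are
equivalences in the 2-categories of 2-functors, pseudonatural transformations and
modifications. (`F.comp G` is `G` after `F`.) -/
def IsPseudoequivalence {B : Type u₁} [Bicategory.{w₁, v₁} B] {D : Type u₂}
    [Bicategory.{w₂, v₂} D] (F : StrictPseudofunctor B D) : Prop :=
  ∃ G : StrictPseudofunctor D B,
    (∃ η : (show HomP B B from StrictPseudofunctor.id B) ⟶ (show HomP B B from F.comp G),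
      IsEquiv η) ∧
    ∃ θ : (show HomP D D from G.comp F) ⟶ (show HomP D D from StrictPseudofunctor.id D),
      IsEquiv θ

/-- `q : B ⟶ E` is the 2-localization of `B` at the class of arrows `S`: it sends the arrows of `S`
into equivalences, and, for every 2-category `D`, precomposition with `q` is a pseudoequivalence
from the 2-category of 2-functors `E ⟶ D` to the 2-category of those 2-functors `B ⟶ D` which send
the arrows of `S` into equivalences. -/
def Is2Localization {B : Type u₁} [Bicategory.{w₁, v₁} B] {E : Type u₂} [Bicategory.{w₂, v₂} E]
    (S : MorphismProperty B) (q : StrictPseudofunctor B E) : Prop :=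
  ∃ hq : Inverts q S, ∀ (D : Type u') [Bicategory.{w', v'} D] [Strict D],
    IsPseudoequivalence (precompose q hq D)

end Localization

/-! ### The 2-functor from a model category to the homotopy 2-category of its fibrant-cofibrant
objects -/

section Model

variable {C : Type u} [Category.{v} C] [ModelCategory C]
  (fac₁ : MorphismProperty.FunctorialFactorizationData (cofibrations C) (trivialFibrations C))
  (fac₂ : MorphismProperty.FunctorialFactorizationData (trivialCofibrations C) (fibrations C))

/-- Cofibrant replacement: `Q X` is the middle object of the factorization of `0 ⟶ X` into a
cofibration followed by a trivial fibration. -/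
noncomputable def Q : C ⥤ C where
  obj X := fac₁.Z.obj (Arrow.mk (initial.to X))
  map f := fac₁.Z.map (Arrow.homMk (𝟙 _) f)
  map_id X := by
    rw [← fac₁.Z.map_id]
    congr 1
  map_comp f g := by
    rw [← fac₁.Z.map_comp]
    congr 1
    ext <;> simp

/-- Fibrant replacement: `R X` is the middle object of the factorization of `X ⟶ 1` into a
trivial cofibration followed by a fibration. -/
noncomputable def R : C ⥤ C where
  obj X := fac₂.Z.obj (Arrow.mk (terminal.from X))
  map f := fac₂.Z.map (Arrow.homMk f (𝟙 _))
  map_id X := by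
    rw [← fac₂.Z.map_id]
    congr 1
  map_comp f g := by
    rw [← fac₂.Z.map_comp]
    congr 1
    ext <;> simp

theorem isBifibrant_RQ (X : C) : bifibrantObjects C ((Q fac₁ ⋙ R fac₂).obj X) := by
  have hc : IsCofibrant ((Q fac₁).obj X) :=
    (isCofibrant_iff_of_isInitial (fac₁.i.app (Arrow.mk (initial.to X))) initialIsInitial).2
      ((cofibration_iff _).2 (fac₁.hi _))
  let i : (Q fac₁).obj X ⟶ (R fac₂).obj ((Q fac₁).obj X) :=
    fac₂.i.app (Arrow.mk (terminal.from ((Q fac₁).obj X)))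
  have hi : Cofibration i := (cofibration_iff _).2 (fac₂.hi _).1
  exact ⟨isCofibrant_of_cofibration i,
    (isFibrant_iff_of_isTerminal (fac₂.p.app (Arrow.mk (terminal.from ((Q fac₁).obj X))))
      terminalIsTerminal).2 ((fibration_iff _).2 (fac₂.hp _))⟩

/-- The corestriction of `R Q` to the full subcategory of fibrant-cofibrant objects. -/
noncomputable def r : C ⥤ BifibrantObject C :=
  (bifibrantObjects C).lift (Q fac₁ ⋙ R fac₂) (isBifibrant_RQ fac₁ fac₂)

variable (C) in
/-- The weak equivalences between fibrant-cofibrant objects. -/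
def Wfc : MorphismProperty (BifibrantObject C) :=
  (weakEquivalences C).inverseImage BifibrantObject.ι

variable (C) in
/-- The homotopy 2-category of the category of fibrant-cofibrant objects at the weak equivalences:
two sequences of homotopies are the same 2-cell when every 2-functor, into any 2-category, which
sends the weak equivalences into equivalences gives them the same value. -/
abbrev HoFC : Type u :=
  HoCat (Set.univ : Set (InvertingFunctor.{max u v, v, u} (Wfc C)))

/-- The composite `q` of `r` with the inclusion of the category of fibrant-cofibrant objects into
its homotopy 2-category. -/
noncomputable def q : StrictPseudofunctor (LocallyDiscrete C) (HoFC C) :=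
  (functorToStrict (r fac₁ fac₂)).comp (HoCat.incl _)

end Model

end TwoLoc

/-! A quasi-inverse of `q^*` is given by restricting a 2-functor on `C` to the bifibrant objects and
then extending it to their homotopy 2-category. Two points need proof: that extension is possible,
and that the two composites are equivalent to identities.

Extension. The inclusion of the bifibrant objects into the homotopy 2-category inverts weak
equivalences (`inverts_incl_bifibrant`): by Whitehead's theorem a weak equivalence between bifibrant
objects has a homotopy inverse, the homotopies can be taken on very good cylinders, whose middle
object is again bifibrant, and homotopies are invertible as 2-cells. An inverting 2-functor extends
by its action on sequences of homotopies (`extend`). A pseudonatural transformation extends with the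
same data, because naturality with respect to 2-cells is automatic (`isNatural_hoCat`): the 2-cells
are generated by those of cylinders, such a 2-cell becomes an identity after whiskering with `s`,
and whiskering with the image of `s`, an equivalence, is faithful.

The homotopy 2-category is defined by testing only on 2-categories of one size. This is harmless
(`hatSeq_eq_of_rel_univ`): the homotopy 2-category built from a single 2-functor into a large
2-category has this size and still detects equality of the values of that 2-functor.

Comparison. Up to extension, both composites are precomposition with `RQ`. On `C` and on the
bifibrant objects alike there is a zigzag of natural weak equivalences from the identity through `Q`
to `RQ`. Each leg `t` induces a pseudonatural transformation between endo-2-functors of a 2-category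
of 2-functors, with value `F(t_X)` at `F` and `X`, an equivalence. A pseudonatural transformation
with equivalences as components is an equivalence (`isEquiv_of_app`); used at two levels, this makes
each leg an equivalence. Inverting one leg and composing with the other gives the unit and the
counit. -/

namespace TwoLoc

/-! ### Cancelling and lifting along equivalences in a 2-category. -/

section Equivalences

variable {B : Type u₁} [Bicategory.{w₁, v₁} B]

theorem IsEquiv.exists_inverse {X Y : B} {f : X ⟶ Y} (hf : IsEquiv f) :
    ∃ g : Y ⟶ X, IsEquiv g := by
  obtain ⟨g, ⟨η⟩, ⟨δ⟩⟩ := hf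
  exact ⟨g, f, ⟨δ.symm⟩, ⟨η.symm⟩⟩

theorem IsEquiv.comp {X Y Z : B} {f : X ⟶ Y} {g : Y ⟶ Z} (hf : IsEquiv f) (hg : IsEquiv g) :
    IsEquiv (f ≫ g) := by
  obtain ⟨f', ⟨η⟩, ⟨δ⟩⟩ := hf
  obtain ⟨g', ⟨η'⟩, ⟨δ'⟩⟩ := hg
  exact ⟨g' ≫ f',
    ⟨η ≪≫ whiskerLeftIso f ((λ_ f').symm ≪≫ whiskerRightIso η' f' ≪≫ α_ _ _ _) ≪≫
      (α_ _ _ _).symm⟩,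
    ⟨α_ _ _ _ ≪≫ whiskerLeftIso g' ((α_ _ _ _).symm ≪≫ whiskerRightIso δ g ≪≫ λ_ g) ≪≫ δ'⟩⟩

theorem IsEquiv.whiskerRight_injective {X Y Z : B} {s : X ⟶ Y} (hs : IsEquiv s) {f g : Z ⟶ X}
    {α β : f ⟶ g} (h : α ▷ s = β ▷ s) : α = β :=
  (hs.existsUnique (β ▷ s)).unique h rfl

theorem IsEquiv.exists_iso {X Y Z : B} {s : X ⟶ Y} (hs : IsEquiv s) {f g : Z ⟶ X}
    (β : f ≫ s ≅ g ≫ s) : ∃ α : f ≅ g, α.hom ▷ s = β.hom := by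
  obtain ⟨a, ha, -⟩ := hs.existsUnique β.hom
  obtain ⟨b, hb, -⟩ := hs.existsUnique β.inv
  exact ⟨⟨a, b, hs.whiskerRight_injective (by simp [ha, hb]),
    hs.whiskerRight_injective (by simp [ha, hb])⟩, ha⟩

theorem IsEquiv.exists_lift {X Y Z : B} {s : X ⟶ Y} (hs : IsEquiv s) (h : Z ⟶ Y) :
    ∃ g : Z ⟶ X, Nonempty (g ≫ s ≅ h) := by
  obtain ⟨t, -, ⟨δ⟩⟩ := hs
  exact ⟨h ≫ t, ⟨α_ _ _ _ ≪≫ whiskerLeftIso h δ ≪≫ ρ_ h⟩⟩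

end Equivalences

/-! ### Pseudonatural transformations whose components are equivalences. -/

section Transformations

variable {B : Type u₁} [Bicategory.{w₁, v₁} B] {D : Type u₂} [Bicategory.{w₂, v₂} D]
  {F G H : Pseudofunctor B D} (α : F ⟶ G)

/-- The invertible 2-cell obtained by pasting a family of 2-cells `γ a ≫ α a ≅ β a` with the
structure 2-cells of `α` and `β`. -/
def liftCell (β : H ⟶ G) (γ : ∀ a, H.obj a ⟶ F.obj a) (e : ∀ a, γ a ≫ α.app a ≅ β.app a)
    {a b : B} (f : a ⟶ b) : (H.map f ≫ γ b) ≫ α.app b ≅ (γ a ≫ F.map f) ≫ α.app b :=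
  α_ _ _ _ ≪≫ whiskerLeftIso (H.map f) (e b) ≪≫ β.naturality f ≪≫
    (whiskerRightIso (e a) (G.map f)).symm ≪≫ α_ _ _ _ ≪≫
    whiskerLeftIso (γ a) (α.naturality f).symm ≪≫ (α_ _ _ _).symm

/-- The pasting of `α` with a 2-cell `γ a ≫ α a ≅ β a`. -/
def pasteCell (β : H ⟶ G) (γ : ∀ a, H.obj a ⟶ F.obj a) (e : ∀ a, γ a ≫ α.app a ≅ β.app a)
    {a b : B} (f : a ⟶ b) : (γ a ≫ F.map f) ≫ α.app b ≅ β.app a ≫ G.map f :=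
  α_ _ _ _ ≪≫ whiskerLeftIso (γ a) (α.naturality f) ≪≫ (α_ _ _ _).symm ≪≫
    whiskerRightIso (e a) (G.map f)

/-- This identity is all that is used of `liftCell`. The three lemmas on `pasteCell` that follow
carry the axioms of `α` for 2-cells, identities and composites through the pasting, so that an axiom
for the lift becomes the same axiom for `β`. -/
theorem liftCell_pasteCell (β : H ⟶ G) (γ : ∀ a, H.obj a ⟶ F.obj a)
    (e : ∀ a, γ a ≫ α.app a ≅ β.app a) {a b : B} (f : a ⟶ b) :
    (liftCell α β γ e f).hom ≫ (pasteCell α β γ e f).hom =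
      (α_ _ _ _).hom ≫ H.map f ◁ (e b).hom ≫ (β.naturality f).hom := by
  simp [liftCell, pasteCell]

theorem pasteCell_naturality (β : H ⟶ G) (γ : ∀ a, H.obj a ⟶ F.obj a)
    (e : ∀ a, γ a ≫ α.app a ≅ β.app a) {a b : B} {f g : a ⟶ b} (θ : f ⟶ g) :
    (γ a ◁ F.map₂ θ) ▷ α.app b ≫ (pasteCell α β γ e g).hom =
      (pasteCell α β γ e f).hom ≫ β.app a ◁ G.map₂ θ := by
  have h := congrArg (fun x => γ a ◁ x) (α.naturality_naturality θ)
  simp only [whiskerLeft_comp] at h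
  simp only [pasteCell, Iso.trans_hom, whiskerLeftIso_hom, whiskerRightIso_hom, Iso.symm_hom,
    Category.assoc, ← whisker_exchange]
  rw [whisker_assoc]
  simp only [Category.assoc, Iso.inv_hom_id_assoc, reassoc_of% h]
  simp

theorem pasteCell_id (β : H ⟶ G) (γ : ∀ a, H.obj a ⟶ F.obj a)
    (e : ∀ a, γ a ≫ α.app a ≅ β.app a) (a : B) :
    (pasteCell α β γ e (𝟙 a)).hom ≫ β.app a ◁ (G.mapId a).hom =
      (γ a ◁ (F.mapId a).hom) ▷ α.app a ≫ ((ρ_ (γ a)).hom ▷ α.app a ≫ (e a).hom ≫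
        (ρ_ (β.app a)).inv) := by
  have h := congrArg (fun x => γ a ◁ x) (α.naturality_id a)
  simp only [whiskerLeft_comp] at h
  simp only [pasteCell, Iso.trans_hom, whiskerLeftIso_hom, whiskerRightIso_hom, Iso.symm_hom,
    Category.assoc, ← whisker_exchange]
  rw [← associator_inv_naturality_right_assoc, reassoc_of% h]
  simp

theorem pasteCell_comp (β : H ⟶ G) (γ : ∀ a, H.obj a ⟶ F.obj a)
    (e : ∀ a, γ a ≫ α.app a ≅ β.app a) {a b c : B} (f : a ⟶ b) (g : b ⟶ c) :
    (pasteCell α β γ e (f ≫ g)).hom ≫ β.app a ◁ (G.mapComp f g).hom =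
      (γ a ◁ (F.mapComp f g).hom) ▷ α.app c ≫ ((α_ _ _ _).inv ▷ α.app c ≫ (α_ _ _ _).hom ≫
        (γ a ≫ F.map f) ◁ (α.naturality g).hom ≫ (α_ _ _ _).inv ≫
        (pasteCell α β γ e f).hom ▷ G.map g ≫ (α_ _ _ _).hom) := by
  have h := congrArg (fun x => γ a ◁ x) (α.naturality_comp f g)
  simp only [whiskerLeft_comp] at h
  simp only [pasteCell, Iso.trans_hom, whiskerLeftIso_hom, whiskerRightIso_hom, Iso.symm_hom,
    Category.assoc, ← whisker_exchange]
  rw [← associator_inv_naturality_right_assoc, reassoc_of% h]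
  simp

variable {α} (hα : ∀ a, IsEquiv (α.app a))

-- The components are lifts of those of `β`, and the structure cells are the unique lifts of
-- `liftCell`. Since whiskering with a component of `α` is faithful, each axiom may be checked after
-- whiskering, where it reduces to that of `β`.
include hα in
theorem exists_lift_trans (β : H ⟶ G) : ∃ γ : H ⟶ F, Nonempty (γ ≫ α ≅ β) := by
  choose γ hγ using fun a => (hα a).exists_lift (β.app a)
  have e := fun a => (hγ a).some
  choose n hn using fun {a b : B} (f : a ⟶ b) => (hα b).exists_iso (liftCell α β γ e f)
  have key : ∀ {a b : B} (f : a ⟶ b), (n f).hom ▷ α.app b ≫ (pasteCell α β γ e f).hom =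
      (α_ _ _ _).hom ≫ H.map f ◁ (e b).hom ≫ (β.naturality f).hom := by
    intro a b f
    rw [hn, liftCell_pasteCell]
  let T : H ⟶ F :=
    { app := γ
      naturality := n
      naturality_naturality := by
        intro a b f g θ
        apply (hα b).whiskerRight_injective
        -- Composing with an invertible pasting cell is what allows `key` to replace the structure
        -- cells of the lift by those of `β`.
        rw [← cancel_mono (pasteCell α β γ e g).hom]
        simp only [comp_whiskerRight, Category.assoc, key, pasteCell_naturality, reassoc_of% key]
        rw [associator_naturality_left_assoc, ← whisker_exchange_assoc, β.naturality_naturality]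
      naturality_id := by
        intro a
        apply (hα a).whiskerRight_injective
        -- The cancelled cell is the tail of the right-hand side of `pasteCell_id`; the same device
        -- serves for composites, with the tail of `pasteCell_comp`.
        rw [← cancel_mono ((ρ_ (γ a)).hom ▷ α.app a ≫ (e a).hom ≫ (ρ_ (β.app a)).inv),
          comp_whiskerRight, Category.assoc, ← pasteCell_id, reassoc_of% key, β.naturality_id,
          whisker_exchange_assoc]
        simp
      naturality_comp := by
        intro a b c f g
        apply (hα c).whiskerRight_injective
        have k₁ := congrArg (fun x => x ▷ G.map g) (key f)
        simp only [comp_whiskerRight] at k₁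
        have k₂ : (H.map f ◁ (n g).hom) ▷ α.app c ≫ (α_ _ _ _).inv ▷ α.app c ≫ (α_ _ _ _).hom ≫
            (H.map f ≫ γ b) ◁ (α.naturality g).hom ≫ (α_ _ _ _).inv ≫
            (α_ _ _ _).hom ▷ G.map g ≫ (H.map f ◁ (e b).hom) ▷ G.map g =
            (α_ _ _ _).hom ≫ H.map f ◁ ((n g).hom ▷ α.app c ≫ (pasteCell α β γ e g).hom) ≫
              (α_ _ _ _).inv := by
          simp [pasteCell]
        rw [← cancel_mono ((α_ _ _ _).inv ▷ α.app c ≫ (α_ _ _ _).hom ≫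
          (γ a ≫ F.map f) ◁ (α.naturality g).hom ≫ (α_ _ _ _).inv ≫
          (pasteCell α β γ e f).hom ▷ G.map g ≫ (α_ _ _ _).hom),
          comp_whiskerRight, Category.assoc, ← pasteCell_comp, reassoc_of% key, β.naturality_comp,
          whisker_exchange_assoc]
        simp only [comp_whiskerRight, Category.assoc]
        simp only [hom_inv_whiskerRight_assoc, associator_naturality_left_assoc,
          ← whisker_exchange_assoc]
        rw [associator_inv_naturality_left_assoc, reassoc_of% k₁,
          reassoc_of% k₂, key, whisker_exchange_assoc]
        simp }
  refine ⟨T, ⟨Pseudofunctor.StrongTrans.isoMk e ?_⟩⟩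
  intro a b f
  have h : H.map f ◁ (e b).hom ≫ (β.naturality f).hom =
      ((α_ _ _ _).inv ≫ (n f).hom ▷ α.app b ≫ (α_ _ _ _).hom ≫ γ a ◁ (α.naturality f).hom ≫
        (α_ _ _ _).inv) ≫ (e a).hom ▷ G.map f := by
    rw [← cancel_epi (α_ _ _ _).hom, ← key]
    simp [pasteCell]
  exact h

-- Fullness of postcomposition with `α`: the components lift one by one, and faithfulness of
-- whiskering with `α.app b` reduces the modification axiom of the lift to that of `m`.
include hα in
theorem exists_lift_modification {γ γ' : H ⟶ F} (m : γ ≫ α ⟶ γ' ≫ α) :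
    ∃ m' : γ ⟶ γ', m' ▷ α = m := by
  have hm : ∀ a, ∃ n : γ.app a ⟶ γ'.app a, n ▷ α.app a = m.as.app a :=
    fun a => ((hα a).existsUnique (m.as.app a)).exists
  choose n hn using hm
  refine ⟨⟨⟨n, ?_⟩⟩, ?_⟩
  · intro a b f
    have h : H.map f ◁ n b ▷ α.app b ≫ (α_ (H.map f) (γ'.app b) (α.app b)).inv ≫
        (γ'.naturality f).hom ▷ α.app b ≫
        (α_ _ _ _).hom ≫ γ'.app a ◁ (α.naturality f).hom ≫ (α_ _ _ _).inv =
        ((α_ (H.map f) (γ.app b) (α.app b)).inv ≫ (γ.naturality f).hom ▷ α.app b ≫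
          (α_ _ _ _).hom ≫ γ.app a ◁ (α.naturality f).hom ≫ (α_ _ _ _).inv) ≫
          n a ▷ α.app a ▷ G.map f := by
      rw [hn a, hn b]
      exact m.as.naturality f
    apply (hα b).whiskerRight_injective
    rw [← cancel_epi (α_ (H.map f) (γ.app b) (α.app b)).inv, ← cancel_mono ((α_ _ _ _).hom ≫
      γ'.app a ◁ (α.naturality f).hom ≫ (α_ _ _ _).inv)]
    simp only [comp_whiskerRight, Category.assoc]
    rw [associator_naturality_left_assoc, ← whisker_exchange_assoc,
      associator_inv_naturality_left, ← associator_inv_naturality_middle_assoc]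
    refine h.trans ?_
    simp only [Category.assoc]
  · ext a
    exact hn a

include hα in
theorem isEquiv_of_app : IsEquiv α := by
  obtain ⟨γ, ⟨e⟩⟩ := exists_lift_trans hα (𝟙 G)
  -- The lift `γ` of the identity is a quasi-inverse on one side only. Both sides here are
  -- isomorphic to `α`, and cancelling `α` by full faithfulness yields the missing isomorphism from
  -- `𝟙 F` to `α ≫ γ`.
  have i : 𝟙 F ≫ α ≅ (α ≫ γ) ≫ α := λ_ α ≪≫ (ρ_ α).symm ≪≫ whiskerLeftIso α e.symm ≪≫ (α_ _ _ _).symm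
  have inj : ∀ {γ γ' : F ⟶ F} {m m' : γ ⟶ γ'}, m ▷ α = m' ▷ α → m = m' := by
    intro γ γ' m m' h
    ext a
    exact (hα a).whiskerRight_injective (congrArg (fun x => x.as.app a) h)
  obtain ⟨m, hm⟩ := exists_lift_modification hα i.hom
  obtain ⟨m', hm'⟩ := exists_lift_modification hα i.inv
  exact ⟨γ, ⟨⟨m, m', inj (by simp [hm, hm']), inj (by simp [hm, hm'])⟩⟩, ⟨e⟩⟩

end Transformations

theorem isEquiv_of_hom {B : Type u₁} {D : Type u₂} [Bicategory.{w₂, v₂} D] {F : B → D}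
    {X Y : InducedBicategory D F} {f : X ⟶ Y} (h : IsEquiv f.hom) : IsEquiv f := by
  obtain ⟨g, ⟨η⟩, ⟨δ⟩⟩ := h
  exact ⟨InducedBicategory.mkHom g, ⟨InducedBicategory.isoMk η⟩, ⟨InducedBicategory.isoMk δ⟩⟩

theorem eqToHom_conj {A : Type u} [Category.{v} A] {X X' Y Y' : A} (x : X ⟶ Y)
    (p : X = X') (q : X' = X) (r : Y = Y') (s : Y' = Y) :
    eqToHom p ≫ (eqToHom q ≫ x ≫ eqToHom r) ≫ eqToHom s = x := by
  subst p r
  simp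

/-! ### The action of the inclusion 2-functor on homotopies. -/

section InclHat

variable {A : Type u} [Category.{v} A] {W : MorphismProperty A}

/-- The homotopy from `d₀` to `d₁` given by the identity of the cylinder. -/
def Cylinder.homotopy {X : A} (C : Cylinder W X) : Homotopy W C.d₀ C.d₁ :=
  ⟨C, 𝟙 _, Category.comp_id _, Category.comp_id _⟩

/-- The sequence consisting of one homotopy. -/
def Homotopy.seq {X Y : A} {f g : X ⟶ Y} (H : Homotopy W f g) : HomotopySeq W f g :=
  .cons H (.nil g)

namespace HoCat

variable {T : Set (InvertingFunctor.{w', v', u'} W)}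

/-- The 2-cell of the homotopy 2-category represented by a sequence of homotopies. -/
def mk₂ (T : Set (InvertingFunctor.{w', v', u'} W)) {X Y : A} {f g : X ⟶ Y}
    (K : HomotopySeq W f g) :
    onArrow (incl T) f ⟶ onArrow (incl T) g :=
  Quotient.mk (seqSetoid T f g) K

variable (P : InvertingFunctor.{w', v', u'} W) (hP : P ∈ T)

theorem ev_mk₂ {X Y : A} {f g : X ⟶ Y} (K : HomotopySeq W f g) :
    ev P hP (mk₂ T K) = hatSeq P.F P.inverts K := rfl

theorem hat_homotopy {D : Type u'} [Bicategory.{w', v'} D] [Strict D]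
    (F : StrictPseudofunctor (LocallyDiscrete A) D)
    (hF : Inverts F (toLoc W)) {X : A} (C : Cylinder W X) :
    hat F hF C.homotopy = hatCylinder F hF C := by
  simp only [hat]
  change _ ≫ hatCylinder F hF C ▷ onArrow F (𝟙 _) ≫ _ = _
  rw [whiskerRight_eq_of_eq (onArrow_id F _), whiskerRight_id]
  simp only [Strict.rightUnitor_eqToIso, eqToIso.hom, eqToIso.inv, Category.assoc, eqToHom_trans,
    eqToHom_trans_assoc]
  exact eqToHom_conj _ _ _ _ _

theorem ev_whiskerRight {X Y Z : HoCat T} {f g : X ⟶ Y} (α : f ⟶ g) (r : Y ⟶ Z) :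
    ev P hP (α ▷ r) = eqToHom (onArrow_eq P.F rfl).symm ≫ ev P hP α ▷ onArrow P.F r.as ≫
        eqToHom (onArrow_eq P.F rfl) := ev_wR P hP α r

/-- Equality of 2-cells is tested on the members of `T`, and each of them sends this class to its
own `hatCylinder`, for which the equation is the defining property. No inverting hypothesis on the
inclusion is needed here. -/
theorem mk₂_whiskerRight {X : A} (C : Cylinder W X) :
    mk₂ T C.homotopy.seq ▷ onArrow (incl T) C.s =
      eqToHom ((onArrow_eq (incl T) C.fac₀).trans (onArrow_eq (incl T) C.fac₁).symm) := by
  apply hom₂_ext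
  intro P hP
  rw [ev_whiskerRight, ev_eqToHom, ev_mk₂]
  simp only [Homotopy.seq, hatSeq, hat_homotopy, Category.comp_id]
  change _ ≫ hatCylinder P.F P.inverts C ▷ onArrow P.F C.s ≫ _ = _
  rw [hatCylinder_spec]
  exact (congrArg (eqToHom _ ≫ ·) (eqToHom_trans _ _)).trans (eqToHom_trans _ _)

variable (hT : Inverts (incl T) (toLoc W))

theorem hatCylinder_incl {X : A} (C : Cylinder W X) :
    hatCylinder (incl T) hT C = mk₂ T C.homotopy.seq :=
  (hatCylinder_unique _ hT C _ (mk₂_whiskerRight C)).symm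

theorem hat_incl {X Y : A} {f g : X ⟶ Y} (H : Homotopy W f g) :
    hat (incl T) hT H = mk₂ T H.seq := by
  apply hom₂_ext
  intro P hP
  rw [ev_mk₂, hat, ev_comp, ev_comp, ev_eqToHom, ev_eqToHom, ev_whiskerRight, hatCylinder_incl,
    ev_mk₂]
  simp only [Homotopy.seq, hatSeq, hat_homotopy, Category.comp_id]
  simp [hat]
  rfl

/-- Once the inclusion inverts `W`, it can itself serve as a test 2-functor, and two sequences with
the same value under it have the same class. The size reduction in `hatSeq_eq_of_rel_univ` rests on
this. -/
theorem hatSeq_incl {X Y : A} {f g : X ⟶ Y} (K : HomotopySeq W f g) :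
    hatSeq (incl T) hT K = mk₂ T K := by
  induction K with
  | nil f => rfl
  | cons H K ih =>
    rw [hatSeq, ih, hat_incl]
    rfl

end HoCat

end InclHat

/-! ### Extension of inverting 2-functors, with targets of any size. -/

section Ext

variable {A : Type u} [Category.{v} A] {W : MorphismProperty A}

theorem hatSeq_eq_of_rel_univ
    (hW : ∀ T : Set (InvertingFunctor.{w', v', u'} W), Inverts (HoCat.incl T) (toLoc W))
    {D : Type u'} [Bicategory.{w', v'} D] [Strict D]
    (F : StrictPseudofunctor (LocallyDiscrete A) D) (hF : Inverts F (toLoc W))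
    {X Y : A} {f g : X ⟶ Y} {K L : HomotopySeq W f g}
    (h : seqSetoid (Set.univ : Set (InvertingFunctor.{max u v, v, u} W)) f g K L) :
    hatSeq F hF K = hatSeq F hF L := by
  let P : InvertingFunctor.{w', v', u'} W := ⟨D, F, hF⟩
  -- The homotopy 2-category for the single test `P` has its size fixed by `A`, however large `D`
  -- is, so it is among the tests that define the relation.
  have h' := h ⟨HoCat {P}, HoCat.incl {P}, hW {P}⟩ trivial
  rw [HoCat.hatSeq_incl, HoCat.hatSeq_incl] at h'
  exact congrArg (HoCat.ev P (Set.mem_singleton P)) (show HoCat.mk₂ {P} K = HoCat.mk₂ {P} L from h')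

/-- The extension to the homotopy 2-category of a 2-functor which sends the arrows of `W` into
equivalences. -/
noncomputable def extend
    (hW : ∀ T : Set (InvertingFunctor.{w', v', u'} W), Inverts (HoCat.incl T) (toLoc W))
    {D : Type u'} [Bicategory.{w', v'} D] [Strict D]
    (F : StrictPseudofunctor (LocallyDiscrete A) D) (hF : Inverts F (toLoc W)) :
    StrictPseudofunctor (HoCat (Set.univ : Set (InvertingFunctor.{max u v, v, u} W))) D :=
  StrictPseudofunctor.mk''
    { obj := fun X => F.obj ⟨X.as⟩
      map := fun f => onArrow F f.as
      map₂ := fun α => Quotient.lift (hatSeq F hF) (fun _ _ h => hatSeq_eq_of_rel_univ hW F hF h) α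
      map₂_id := fun _ => rfl
      map₂_comp := fun α β => by
        induction α using Quotient.inductionOn
        induction β using Quotient.inductionOn
        exact hatSeq_append F hF _ _
      map_id := fun X => onArrow_id F X.as
      map_comp := fun f g => (onArrow_eq F rfl).symm
      map₂_whisker_left := fun f _ _ α => by
        induction α using Quotient.inductionOn
        exact hatSeq_precomp F hF _ _
      map₂_whisker_right := fun α g => by
        induction α using Quotient.inductionOn
        exact hatSeq_postcomp F hF _ _ }

end Ext

/-! ### Naturality with respect to one 2-cell, and its behaviour under composition and whiskering.
-/

section Naturality

variable {B : Type u₁} [Bicategory.{w₁, v₁} B] {D : Type u₂} [Bicategory.{w₂, v₂} D]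
  {U V : Pseudofunctor B D} {app : ∀ X, U.obj X ⟶ V.obj X}
  {nat : ∀ {X Y : B} (f : X ⟶ Y), U.map f ≫ app Y ≅ app X ≫ V.map f}

variable (nat) in
/-- Naturality with respect to a 2-cell. -/
def IsNatural {X Y : B} {f g : X ⟶ Y} (η : f ⟶ g) : Prop :=
  U.map₂ η ▷ app Y ≫ (nat g).hom = (nat f).hom ≫ app X ◁ V.map₂ η

theorem IsNatural.id {X Y : B} (f : X ⟶ Y) : IsNatural nat (𝟙 f) := by
  simp [IsNatural]

theorem IsNatural.eqToHom {X Y : B} {f g : X ⟶ Y} (h : f = g) :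
    IsNatural nat (eqToHom h) := by
  subst h
  exact IsNatural.id _

theorem IsNatural.comp {X Y : B} {f g h : X ⟶ Y} {η : f ⟶ g} {θ : g ⟶ h}
    (hη : IsNatural nat η) (hθ : IsNatural nat θ) : IsNatural nat (η ≫ θ) := by
  unfold IsNatural at *
  simp [hθ, reassoc_of% hη]

variable (ncomp : ∀ {X Y Z : B} (f : X ⟶ Y) (g : Y ⟶ Z),
  (nat (f ≫ g)).hom ≫ app X ◁ (V.mapComp f g).hom =
    (U.mapComp f g).hom ▷ app Z ≫ (α_ _ _ _).hom ≫ U.map f ◁ (nat g).hom ≫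
      (α_ _ _ _).inv ≫ (nat f).hom ▷ V.map g ≫ (α_ _ _ _).hom)

include ncomp

/-- The composition axiom splits the structure cell at `f ≫ s`. The part belonging to `s` is
invertible and cancels, leaving the naturality square of `η` whiskered with `V.map s`. -/
theorem isNatural_whiskerRight_iff {X Y Z : B} {f g : X ⟶ Y} (η : f ⟶ g) (s : Y ⟶ Z) :
    IsNatural nat (η ▷ s) ↔
      (U.map₂ η ▷ app Y ≫ (nat g).hom) ▷ V.map s =
        ((nat f).hom ≫ app X ◁ V.map₂ η) ▷ V.map s := by
  unfold IsNatural
  have h₁ := ncomp g s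
  have h₂ := ncomp f s
  rw [← cancel_mono (app X ◁ (V.mapComp g s).hom), Category.assoc, h₁]
  simp only [Pseudofunctor.map₂_whisker_right, comp_whiskerRight, whiskerLeft_comp,
    Category.assoc, whiskerLeft_inv_hom, Category.comp_id, reassoc_of% h₂,
    inv_hom_whiskerRight_assoc]
  rw [cancel_epi, associator_naturality_left_assoc, cancel_epi, ← whisker_exchange_assoc,
    associator_inv_naturality_left_assoc, cancel_epi, cancel_epi]
  rw [← associator_naturality_middle]
  simp only [← Category.assoc, ← comp_whiskerRight, cancel_mono]

theorem IsNatural.whiskerRight {X Y Z : B} {f g : X ⟶ Y} {η : f ⟶ g} (hη : IsNatural nat η)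
    (s : Y ⟶ Z) : IsNatural nat (η ▷ s) :=
  (isNatural_whiskerRight_iff ncomp η s).2 (by rw [hη])

theorem IsNatural.of_whiskerRight {X Y Z : B} {f g : X ⟶ Y} {η : f ⟶ g} {s : Y ⟶ Z}
    (hs : IsEquiv (V.map s)) (h : IsNatural nat (η ▷ s)) : IsNatural nat η :=
  hs.whiskerRight_injective ((isNatural_whiskerRight_iff ncomp η s).1 h)

end Naturality

/-! ### Automatic naturality on the homotopy 2-category. -/

section TransHoCat

variable {A : Type u} [Category.{v} A] {W : MorphismProperty A}
  {T : Set (InvertingFunctor.{w', v', u'} W)} (hT : Inverts (HoCat.incl T) (toLoc W))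
  {D : Type u₂} [Bicategory.{w₂, v₂} D] {U V : StrictPseudofunctor (HoCat T) D}
  {app : ∀ X, U.obj X ⟶ V.obj X}
  {nat : ∀ {X Y : HoCat T} (f : X ⟶ Y), U.map f ≫ app Y ≅ app X ≫ V.map f}
  (ncomp : ∀ {X Y Z : HoCat T} (f : X ⟶ Y) (g : Y ⟶ Z),
    (nat (f ≫ g)).hom ≫ app X ◁ (V.mapComp f g).hom =
      (U.mapComp f g).hom ▷ app Z ≫ (α_ _ _ _).hom ≫ U.map f ◁ (nat g).hom ≫
        (α_ _ _ _).inv ≫ (nat f).hom ▷ V.map g ≫ (α_ _ _ _).hom)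

include hT ncomp

/-- Whiskered with `s`, this 2-cell becomes an identity, for which naturality is trivial; `V` sends
`s` to an equivalence, so the whiskering can be removed. -/
theorem isNatural_cylinder {X : A} (C : Cylinder W X) :
    IsNatural (U := U.toPseudofunctor) (V := V.toPseudofunctor) nat
      (HoCat.mk₂ T C.homotopy.seq) := by
  refine IsNatural.of_whiskerRight (s := onArrow (HoCat.incl T) C.s) ncomp
    (IsEquiv.map V (hT C.s.toLoc C.hs)) ?_
  rw [HoCat.mk₂_whiskerRight]
  exact IsNatural.eqToHom _

theorem isNatural_homotopy {X Y : A} {f g : X ⟶ Y} (H : Homotopy W f g) :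
    IsNatural (U := U.toPseudofunctor) (V := V.toPseudofunctor) nat
      (HoCat.mk₂ T H.seq) := by
  -- Up to equalities of arrows, the class of a homotopy is the 2-cell of its cylinder whiskered
  -- with `h`.
  rw [← HoCat.hat_incl hT H, hat, HoCat.hatCylinder_incl]
  exact (IsNatural.eqToHom _).comp
    (((isNatural_cylinder hT ncomp H.C).whiskerRight ncomp _).comp (IsNatural.eqToHom _))

theorem isNatural_seq {X Y : A} {f g : X ⟶ Y} (K : HomotopySeq W f g) :
    IsNatural (U := U.toPseudofunctor) (V := V.toPseudofunctor) nat (HoCat.mk₂ T K) := by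
  induction K with
  | nil f => exact IsNatural.id _
  | cons H K ih => exact (isNatural_homotopy hT ncomp H).comp ih

theorem isNatural_hoCat {X Y : HoCat T} {f g : X ⟶ Y} (η : f ⟶ g) :
    IsNatural (U := U.toPseudofunctor) (V := V.toPseudofunctor) nat η := by
  induction η using Quotient.inductionOn with
  | _ K => exact isNatural_seq hT ncomp K

omit ncomp in
/-- A pseudonatural transformation between 2-functors on the homotopy 2-category is determined by
its values at the arrows. -/
def mkTransHoCat (app : ∀ X, U.obj X ⟶ V.obj X)
    (nat : ∀ {X Y : HoCat T} (f : X ⟶ Y), U.map f ≫ app Y ≅ app X ≫ V.map f)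
    (nid : ∀ X : HoCat T, (nat (𝟙 X)).hom ≫ app X ◁ (V.mapId X).hom =
      (U.mapId X).hom ▷ app X ≫ (λ_ (app X)).hom ≫ (ρ_ (app X)).inv)
    (ncomp : ∀ {X Y Z : HoCat T} (f : X ⟶ Y) (g : Y ⟶ Z),
      (nat (f ≫ g)).hom ≫ app X ◁ (V.mapComp f g).hom =
        (U.mapComp f g).hom ▷ app Z ≫ (α_ _ _ _).hom ≫ U.map f ◁ (nat g).hom ≫
          (α_ _ _ _).inv ≫ (nat f).hom ▷ V.map g ≫ (α_ _ _ _).hom) :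
    U.toPseudofunctor ⟶ V.toPseudofunctor where
  app := app
  naturality := nat
  naturality_naturality η := isNatural_hoCat hT ncomp η
  naturality_id := nid
  naturality_comp := ncomp

end TransHoCat

/-! ### Extension as a 2-functor on 2-categories of 2-functors. -/

section ExtendFunctor

variable {A : Type u} [Category.{v} A] {W : MorphismProperty A}
  (hW : ∀ T : Set (InvertingFunctor.{w', v', u'} W), Inverts (HoCat.incl T) (toLoc W))
  (hT : Inverts (HoCat.incl (Set.univ : Set (InvertingFunctor.{max u v, v, u} W))) (toLoc W))
  {D : Type u'} [Bicategory.{w', v'} D] [Strict D]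

/-- The extension of a pseudonatural transformation to the homotopy 2-category. -/
noncomputable def extendTrans {F G : StrictPseudofunctor (LocallyDiscrete A) D}
    (hF : Inverts F (toLoc W)) (hG : Inverts G (toLoc W))
    (α : F.toPseudofunctor ⟶ G.toPseudofunctor) :
    (extend hW F hF).toPseudofunctor ⟶ (extend hW G hG).toPseudofunctor :=
  mkTransHoCat hT (U := extend hW F hF) (V := extend hW G hG)
    (fun X => α.app ⟨X.as⟩) (fun f => α.naturality f.as.toLoc)
    (fun X => by
      have h := α.naturality_id ⟨X.as⟩
      -- The unit cells of the extensions are `eqToIso` by construction; those of `F` and `G` must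
      -- be put in this form before the two axioms agree definitionally. Composites are treated in
      -- the same way.
      rw [F.mapId_eq_eqToIso, G.mapId_eq_eqToIso] at h
      exact h)
    (fun f g => by
      have h := α.naturality_comp f.as.toLoc g.as.toLoc
      rw [F.mapComp_eq_eqToIso, G.mapComp_eq_eqToIso] at h
      exact h)

/-- The extension of a modification to the homotopy 2-category. -/
noncomputable def extendMod {F G : StrictPseudofunctor (LocallyDiscrete A) D}
    (hF : Inverts F (toLoc W)) (hG : Inverts G (toLoc W))
    {α β : F.toPseudofunctor ⟶ G.toPseudofunctor} (m : α ⟶ β) :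
    extendTrans hW hT hF hG α ⟶ extendTrans hW hT hF hG β where
  as :=
    { app := fun X => m.as.app ⟨X.as⟩
      naturality := fun f => m.as.naturality f.as.toLoc }

variable (D) in
/-- The extension to the homotopy 2-category of an object of `HomPPlus`. -/
noncomputable def extendObj (F : HomPPlus D (toLoc W)) :
    HomP (HoCat (Set.univ : Set (InvertingFunctor.{max u v, v, u} W))) D :=
  extend hW F.1 F.2

variable (D) in
/-- Extension to the homotopy 2-category, as a 2-functor. -/
noncomputable def extendFunctor :
    StrictPseudofunctor (HomPPlus D (toLoc W))
      (HomP (HoCat (Set.univ : Set (InvertingFunctor.{max u v, v, u} W))) D) :=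
  StrictPseudofunctor.mk'
    { obj := extendObj hW D
      map := fun {F G} α => InducedBicategory.mkHom (extendTrans hW hT F.2 G.2 α.hom)
      map₂ := fun {F G _ _} m => InducedBicategory.mkHom₂ (extendMod hW hT F.2 G.2 m.hom)
      map_id := fun F => rfl
      map_comp := fun α β => rfl
      map₂_whisker_left := fun f _ _ η => eqToHom_sandwich rfl _ _
      map₂_whisker_right := fun η g => eqToHom_sandwich rfl _ _
      map₂_left_unitor := fun f => eqToHom_comp_eq rfl _
      map₂_right_unitor := fun f => eqToHom_comp_eq rfl _
      map₂_associator := fun f g h => eqToHom_sandwich rfl _ _ }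

end ExtendFunctor

/-! ### Precomposition between the 2-categories of inverting 2-functors. -/

section PrecomposePlus

variable {B : Type u₁} [Bicategory.{w₁, v₁} B] {E : Type u₂} [Bicategory.{w₂, v₂} E]

/-- The 2-functor `F ∘ a`, where `a` sends the arrows of `S` into arrows of `S'`. -/
def precomposePlusObj {S : MorphismProperty B} {S' : MorphismProperty E}
    (a : StrictPseudofunctor B E) (ha : ∀ ⦃X Y : B⦄ (f : X ⟶ Y), S f → S' (a.map f))
    (D : Type u₃) [Bicategory.{w₃, v₃} D] (F : HomPPlus D S') : HomPPlus D S :=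
  ⟨a.comp F.1, fun _ _ f hf => F.2 (a.map f) (ha f hf)⟩

/-- Precomposition with a 2-functor `a` which sends the arrows of `S` into arrows of `S'`. -/
def precomposePlus {S : MorphismProperty B} {S' : MorphismProperty E}
    (a : StrictPseudofunctor B E) (ha : ∀ ⦃X Y : B⦄ (f : X ⟶ Y), S f → S' (a.map f))
    (D : Type u₃) [Bicategory.{w₃, v₃} D] :
    StrictPseudofunctor (HomPPlus D S') (HomPPlus D S) :=
  StrictPseudofunctor.mk'
    { obj := precomposePlusObj a ha D
      map := fun α => InducedBicategory.mkHom (whiskerTrans a α.hom)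
      map₂ := fun m => InducedBicategory.mkHom₂ (whiskerMod a m.hom)
      map_id := fun F => rfl
      map_comp := fun α β => rfl
      map₂_whisker_left := fun f _ _ η => eqToHom_sandwich rfl _ _
      map₂_whisker_right := fun η g => eqToHom_sandwich rfl _ _
      map₂_left_unitor := fun f => eqToHom_comp_eq rfl _
      map₂_right_unitor := fun f => eqToHom_comp_eq rfl _
      map₂_associator := fun f g h => eqToHom_sandwich rfl _ _ }

end PrecomposePlus

/-! ### Strictly natural families of arrows as pseudonatural transformations. -/

section StrictTransformations

variable {B : Type u₁} [Bicategory.{w₁, v₁} B] {D : Type u₂} [Bicategory.{w₂, v₂} D] [Strict D]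
  {U V : StrictPseudofunctor B D} {app : ∀ X, U.obj X ⟶ V.obj X}
  (h : ∀ {X Y : B} (f : X ⟶ Y), U.map f ≫ app Y = app X ≫ V.map f)

theorem eqToIso_naturality_id (X : B) :
    (eqToIso (h (𝟙 X))).hom ≫ app X ◁ (V.mapId X).hom =
      (U.mapId X).hom ▷ app X ≫ (λ_ (app X)).hom ≫ (ρ_ (app X)).inv := by
  simp [V.mapId_eq_eqToIso, U.mapId_eq_eqToIso, Strict.leftUnitor_eqToIso,
    Strict.rightUnitor_eqToIso]

theorem eqToIso_naturality_comp {X Y Z : B} (f : X ⟶ Y) (g : Y ⟶ Z) :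
    (eqToIso (h (f ≫ g))).hom ≫ app X ◁ (V.mapComp f g).hom =
      (U.mapComp f g).hom ▷ app Z ≫ (α_ _ _ _).hom ≫ U.map f ◁ (eqToIso (h g)).hom ≫
        (α_ _ _ _).inv ≫ (eqToIso (h f)).hom ▷ V.map g ≫ (α_ _ _ _).hom := by
  simp [V.mapComp_eq_eqToIso, U.mapComp_eq_eqToIso, Strict.associator_eqToIso]

end StrictTransformations

/-- The 2-natural transformation between 2-functors on the homotopy 2-category given by a natural
family of arrows. -/
def strictTransHoCat {A : Type u} [Category.{v} A] {W : MorphismProperty A}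
    {T : Set (InvertingFunctor.{w', v', u'} W)} (hT : Inverts (HoCat.incl T) (toLoc W))
    {D : Type u₂} [Bicategory.{w₂, v₂} D] [Strict D] (U V : StrictPseudofunctor (HoCat T) D)
    (app : ∀ X, U.obj X ⟶ V.obj X)
    (h : ∀ {X Y : HoCat T} (f : X ⟶ Y), U.map f ≫ app Y = app X ≫ V.map f) :
    U.toPseudofunctor ⟶ V.toPseudofunctor :=
  mkTransHoCat hT app (fun f => eqToIso (h f)) (eqToIso_naturality_id h)
    (eqToIso_naturality_comp h)

/-- The 2-natural transformation between 2-functors on a category given by a natural family of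
arrows. -/
def strictTransLocallyDiscrete {A : Type u} [Category.{v} A]
    {D : Type u₂} [Bicategory.{w₂, v₂} D] [Strict D]
    (U V : StrictPseudofunctor (LocallyDiscrete A) D)
    (app : ∀ X, U.obj X ⟶ V.obj X)
    (h : ∀ {X Y : LocallyDiscrete A} (f : X ⟶ Y), U.map f ≫ app Y = app X ≫ V.map f) :
    U.toPseudofunctor ⟶ V.toPseudofunctor where
  app := app
  naturality f := eqToIso (h f)
  naturality_naturality {X Y f g} η := by
    obtain rfl := LocallyDiscrete.eq_of_hom η
    obtain rfl : η = 𝟙 _ := Subsingleton.elim _ _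
    simp
  naturality_id := eqToIso_naturality_id h
  naturality_comp := eqToIso_naturality_comp h

theorem map_square {B : Type u₁} [Bicategory.{w₁, v₁} B] {D : Type u₂} [Bicategory.{w₂, v₂} D]
    (F : StrictPseudofunctor B D) {X Y X' Y' : B} {f : X ⟶ Y} {f' : X' ⟶ Y'} {t : X ⟶ X'}
    {s : Y ⟶ Y'} (e : f ≫ s = t ≫ f') : F.map f ≫ F.map s = F.map t ≫ F.map f' := by
  rw [← F.map_comp, e, F.map_comp]

/-! ### Coherence for whiskering a pseudonatural transformation with a natural family. -/

section Cube

variable {E : Type u₁} [Bicategory.{w₁, v₁} E] {D : Type u₂} [Bicategory.{w₂, v₂} D]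
  {F G : StrictPseudofunctor E D} (α : F.toPseudofunctor ⟶ G.toPseudofunctor)

/-- This is naturality of `α` with respect to the identity 2-cell joining the two sides of a
commutative square, with both sides expanded by the composition axiom. It makes the inverse
structure cells of `α` at the arrows `t_X` into a modification. -/
theorem cube {X Y X' Y' : E} {f : X ⟶ Y} {f' : X' ⟶ Y'} {t : X ⟶ X'} {s : Y ⟶ Y'}
    (e : f ≫ s = t ≫ f') :
    F.map f ◁ (α.naturality s).inv ≫ (α_ _ _ _).inv ≫ eqToHom (map_square F e) ▷ α.app Y' ≫ (α_ _ _ _).hom ≫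
        F.map t ◁ (α.naturality f').hom ≫ (α_ _ _ _).inv =
      ((α_ _ _ _).inv ≫ (α.naturality f).hom ▷ G.map s ≫ (α_ _ _ _).hom ≫ α.app X ◁ eqToHom (map_square G e) ≫
        (α_ _ _ _).inv) ≫ (α.naturality t).inv ▷ G.map f' := by
  have h₃ := α.naturality_naturality (eqToHom e)
  rw [Pseudofunctor.StrongTrans.naturality_comp_hom, Pseudofunctor.StrongTrans.naturality_comp_hom,
    F.mapComp_eq_eqToIso, F.mapComp_eq_eqToIso, G.mapComp_eq_eqToIso, G.mapComp_eq_eqToIso,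
    PrelaxFunctor.map₂_eqToHom, PrelaxFunctor.map₂_eqToHom] at h₃
  have key : eqToHom (map_square F e) ▷ α.app Y' ≫ (α_ _ _ _).hom ≫ F.map t ◁ (α.naturality f').hom ≫
      (α_ _ _ _).inv ≫ (α.naturality t).hom ▷ G.map f' =
      (α_ _ _ _).hom ≫ F.map f ◁ (α.naturality s).hom ≫ (α_ _ _ _).inv ≫
        (α.naturality f).hom ▷ G.map s ≫ (α_ _ _ _).hom ≫ α.app X ◁ eqToHom (map_square G e) ≫
        (α_ _ _ _).inv := by
    rw [← cancel_epi (eqToHom (F.map_comp f s) ▷ α.app Y'),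
      ← cancel_mono ((α_ _ _ _).hom ≫ α.app X ◁ eqToHom (G.map_comp t f').symm)]
    simp only [eqToIso.hom, eqToIso.inv, whiskerLeft_eqToHom, eqToHom_whiskerRight, Category.assoc,
      eqToHom_trans, eqToHom_trans_assoc, Iso.inv_hom_id_assoc] at h₃ ⊢
    exact h₃
  rw [← cancel_epi (F.map f ◁ (α.naturality s).hom),
    ← cancel_mono ((α.naturality t).hom ▷ G.map f')]
  simp only [Category.assoc, whiskerLeft_hom_inv_assoc, key, inv_hom_whiskerRight,
    Category.comp_id, Iso.inv_hom_id_assoc]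

theorem modification_naturality_inv {α β : F.toPseudofunctor ⟶ G.toPseudofunctor} (m : α ⟶ β)
    {X Y : E} (t : X ⟶ Y) :
    m.as.app X ▷ G.map t ≫ (β.naturality t).inv =
      (α.naturality t).inv ≫ F.map t ◁ m.as.app Y := by
  rw [Iso.comp_inv_eq, Category.assoc, m.as.naturality t, Iso.inv_hom_id_assoc]

/-- The whiskered identities are the components of the unit cells of the endo-2-functors compared
below, which come from reflexive equalities. The statement is the unit axiom read at one object;
`comp_naturality_inv` does the same for composites. -/
theorem id_naturality_inv {X Y : E} (t : X ⟶ Y) :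
    ((𝟙 F.toPseudofunctor : F.toPseudofunctor ⟶ _).naturality t).inv ≫
        F.map t ◁ 𝟙 (𝟙 (F.obj Y)) =
      𝟙 (𝟙 (F.obj X)) ▷ F.map t ≫ (λ_ _).hom ≫ (ρ_ _).inv := by
  erw [whiskerLeft_id, Category.comp_id, id_whiskerRight, Category.id_comp]
  simp
  rfl

theorem comp_naturality_inv {H : StrictPseudofunctor E D}
    (β : G.toPseudofunctor ⟶ H.toPseudofunctor) {X Y : E} (t : X ⟶ Y) :
    ((α ≫ β).naturality t).inv ≫ F.map t ◁ 𝟙 (α.app Y ≫ β.app Y) =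
      𝟙 (α.app X ≫ β.app X) ▷ H.map t ≫ (α_ _ _ _).hom ≫ α.app X ◁ (β.naturality t).inv ≫
        (α_ _ _ _).inv ≫ (α.naturality t).inv ▷ β.app Y ≫ (α_ _ _ _).hom := by
  erw [whiskerLeft_id, Category.comp_id, id_whiskerRight, Category.id_comp]
  simp
  erw [Category.assoc, Category.assoc, Category.assoc]
  rfl

end Cube

/-- The 2-functor underlying an object of `HomP B D`. -/
abbrev HomP.toStrict {B : Type u₁} [Bicategory.{w₁, v₁} B] {D : Type u₂} [Bicategory.{w₂, v₂} D]
    (F : HomP B D) : StrictPseudofunctor B D := F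

/-! ### Zigzags of natural weak equivalences yield a pseudoequivalence. -/

section Zigzag

variable {A : Type u} [Category.{v} A] {W : MorphismProperty A}
  (hW : ∀ T : Set (InvertingFunctor.{w', v', u'} W), Inverts (HoCat.incl T) (toLoc W))
  (hT : Inverts (HoCat.incl (Set.univ : Set (InvertingFunctor.{max u v, v, u} W))) (toLoc W))
  (D : Type u') [Bicategory.{w', v'} D] [Strict D]

variable (W) in
/-- The homotopy 2-category defined by all the 2-functors into 2-categories of the smallest
relevant size. -/
abbrev Ho : Type u := HoCat (Set.univ : Set (InvertingFunctor.{max u v, v, u} W))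

/-- The endo-2-functor of the 2-category of 2-functors on the homotopy 2-category which is given by
precomposition with an endofunctor `a` of `A`. -/
noncomputable def precomposeHo (a : A ⥤ A) (ha : ∀ ⦃X Y : A⦄ (f : X ⟶ Y), W f → W (a.map f)) :
    StrictPseudofunctor (HomP (Ho W) D) (HomP (Ho W) D) :=
  (precompose (HoCat.incl _) hT D).comp
    ((precomposePlus (S := toLoc W) (S' := toLoc W) (functorToStrict a) (fun _ _ f hf => ha f.as hf)
      D).comp (extendFunctor hW hT D))

variable {a : A ⥤ A} (ha : ∀ ⦃X Y : A⦄ (f : X ⟶ Y), W f → W (a.map f))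

/-- The pseudonatural transformation of endo-2-functors induced by a natural transformation from
`a` to the identity. -/
noncomputable def precomposeHoToId (t : a ⟶ 𝟭 A) :
    (precomposeHo hW hT D a ha).toPseudofunctor ⟶
      (StrictPseudofunctor.id (HomP (Ho W) D)).toPseudofunctor where
  app F := InducedBicategory.mkHom (strictTransHoCat hT
    (HomP.toStrict ((precomposeHo hW hT D a ha).obj F)) (HomP.toStrict F)
    (fun X => (HomP.toStrict F).map (HoCat.Hom.mk (t.app X.as)))
    (fun {X Y} f => map_square (HomP.toStrict F) (HoCat.Hom.ext (t.naturality f.as))))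
  -- At `X` the required cell exchanges `α` with the family `F(t_X)`, `G(t_X)`: it is the structure
  -- cell of `α` at `t_X`, reversed.
  naturality {F G} α := InducedBicategory.isoMk (Pseudofunctor.StrongTrans.isoMk
    (fun X => (α.hom.naturality (HoCat.Hom.mk (t.app X.as))).symm)
    (fun {X Y} f => cube α.hom (HoCat.Hom.ext (t.naturality f.as))))
  naturality_naturality {F G α β} m := by
    ext X
    exact modification_naturality_inv m.hom _
  naturality_id F := by
    rw [StrictlyUnitaryPseudofunctor.mapId_eq_eqToIso, StrictlyUnitaryPseudofunctor.mapId_eq_eqToIso]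
    ext X
    exact id_naturality_inv (F := HomP.toStrict F) _
  naturality_comp α β := by
    rw [StrictPseudofunctor.mapComp_eq_eqToIso, StrictPseudofunctor.mapComp_eq_eqToIso]
    ext X
    exact comp_naturality_inv α.hom β.hom _

variable {C : Type u} [Category.{v} C] {S : MorphismProperty C} {p : C ⥤ A} {j : A ⥤ C}
  (hp : ∀ ⦃X Y : C⦄ (f : X ⟶ Y), S f → W (p.map f))
  (hj : ∀ ⦃X Y : A⦄ (f : X ⟶ Y), W f → S (j.map f))

variable (p) in
/-- The 2-functor from `C` to the homotopy 2-category of `A` given by a functor `C ⥤ A`. -/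
def toHo : StrictPseudofunctor (LocallyDiscrete C) (Ho W) :=
  (functorToStrict p).comp (HoCat.incl _)

include hT hp in
theorem inverts_toHo : Inverts (toHo (W := W) p) (toLoc S) :=
  fun _ _ f hf => hT ((functorToStrict p).map f) (hp f.as hf)

/-- Restriction along `j : A ⥤ C` followed by extension to the homotopy 2-category of `A`. -/
noncomputable def restrictExtend :
    StrictPseudofunctor (HomPPlus D (toLoc S)) (HomP (Ho W) D) :=
  (precomposePlus (S := toLoc W) (S' := toLoc S) (functorToStrict j) (fun _ _ f hf => hj f.as hf)
    D).comp (extendFunctor hW hT D)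

/-- The endo-2-functor of the 2-category of 2-functors on the homotopy 2-category of `A` which is
the composite of `restrictExtend` with precomposition with `toHo`. -/
noncomputable def unitTarget : StrictPseudofunctor (HomP (Ho W) D) (HomP (Ho W) D) :=
  (precompose (S := toLoc S) (toHo p) (inverts_toHo hT hp) D).comp (restrictExtend hW hT D hj)

/-- The endo-2-functor of the 2-category of 2-functors on `C` which is the composite of
precomposition with `toHo` with `restrictExtend`. -/
noncomputable def counitSource :
    StrictPseudofunctor (HomPPlus D (toLoc S)) (HomPPlus D (toLoc S)) :=
  (restrictExtend hW hT D hj).comp (precompose (S := toLoc S) (toHo p) (inverts_toHo hT hp) D)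

/-- The pseudonatural transformation of endo-2-functors induced by a natural transformation from
`a` to `j ⋙ p`. -/
noncomputable def precomposeHoToUnitTarget (t : a ⟶ j ⋙ p) :
    (precomposeHo hW hT D a ha).toPseudofunctor ⟶
      (unitTarget hW hT D hp hj).toPseudofunctor where
  app F := InducedBicategory.mkHom (strictTransHoCat hT
    (HomP.toStrict ((precomposeHo hW hT D a ha).obj F))
    (HomP.toStrict ((unitTarget hW hT D hp hj).obj F))
    (fun X => (HomP.toStrict F).map (HoCat.Hom.mk (t.app X.as)))
    (fun {X Y} f => map_square (HomP.toStrict F) (HoCat.Hom.ext (t.naturality f.as))))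
  naturality {F G} α := InducedBicategory.isoMk (Pseudofunctor.StrongTrans.isoMk
    (fun X => (α.hom.naturality (HoCat.Hom.mk (t.app X.as))).symm)
    (fun {X Y} f => cube α.hom (HoCat.Hom.ext (t.naturality f.as))))
  naturality_naturality {F G α β} m := by
    ext X
    exact modification_naturality_inv m.hom _
  naturality_id F := by
    rw [StrictlyUnitaryPseudofunctor.mapId_eq_eqToIso,
      StrictlyUnitaryPseudofunctor.mapId_eq_eqToIso]
    ext X
    exact id_naturality_inv (F := HomP.toStrict F) _
  naturality_comp α β := by
    rw [StrictPseudofunctor.mapComp_eq_eqToIso, StrictPseudofunctor.mapComp_eq_eqToIso]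
    ext X
    exact comp_naturality_inv α.hom β.hom _

variable {b : C ⥤ C} (hb : ∀ ⦃X Y : C⦄ (f : X ⟶ Y), S f → S (b.map f))

variable (b) in
/-- The endo-2-functor of `HomPPlus D (toLoc S)` given by precomposition with an endofunctor of
`C`. -/
abbrev precomposeC : StrictPseudofunctor (HomPPlus D (toLoc S)) (HomPPlus D (toLoc S)) :=
  precomposePlus (S := toLoc S) (S' := toLoc S) (functorToStrict b) (fun _ _ f hf => hb f.as hf) D

/-- The pseudonatural transformation of endo-2-functors induced by a natural transformation from
`b` to the identity. -/
def precomposeCToId (t : b ⟶ 𝟭 C) :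
    (precomposeC D b hb).toPseudofunctor ⟶
      (StrictPseudofunctor.id (HomPPlus D (toLoc S))).toPseudofunctor where
  app F := InducedBicategory.mkHom (strictTransLocallyDiscrete
    ((precomposeC D b hb).obj F).1 F.1
    (fun X => F.1.map (t.app X.as).toLoc)
    (fun {X Y} f => map_square F.1 (congrArg Quiver.Hom.toLoc (t.naturality f.as))))
  naturality {F G} α := InducedBicategory.isoMk (Pseudofunctor.StrongTrans.isoMk
    (fun X => (α.hom.naturality (t.app X.as).toLoc).symm)
    (fun {X Y} f => cube α.hom (congrArg Quiver.Hom.toLoc (t.naturality f.as))))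
  naturality_naturality {F G α β} m := by
    ext X
    exact modification_naturality_inv m.hom _
  naturality_id F := by
    rw [StrictlyUnitaryPseudofunctor.mapId_eq_eqToIso,
      StrictlyUnitaryPseudofunctor.mapId_eq_eqToIso]
    ext X
    exact id_naturality_inv (F := F.1) _
  naturality_comp α β := by
    rw [StrictPseudofunctor.mapComp_eq_eqToIso, StrictPseudofunctor.mapComp_eq_eqToIso]
    ext X
    exact comp_naturality_inv α.hom β.hom _

/-- The pseudonatural transformation of endo-2-functors induced by a natural transformation from
`b` to `p ⋙ j`. -/
noncomputable def precomposeCToCounitSource (t : b ⟶ p ⋙ j) :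
    (precomposeC D b hb).toPseudofunctor ⟶
      (counitSource hW hT D hp hj).toPseudofunctor where
  app F := InducedBicategory.mkHom (strictTransLocallyDiscrete
    ((precomposeC D b hb).obj F).1 ((counitSource hW hT D hp hj).obj F).1
    (fun X => F.1.map (t.app X.as).toLoc)
    (fun {X Y} f => map_square F.1 (congrArg Quiver.Hom.toLoc (t.naturality f.as))))
  naturality {F G} α := InducedBicategory.isoMk (Pseudofunctor.StrongTrans.isoMk
    (fun X => (α.hom.naturality (t.app X.as).toLoc).symm)
    (fun {X Y} f => cube α.hom (congrArg Quiver.Hom.toLoc (t.naturality f.as))))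
  naturality_naturality {F G α β} m := by
    ext X
    exact modification_naturality_inv m.hom _
  naturality_id F := by
    rw [StrictlyUnitaryPseudofunctor.mapId_eq_eqToIso,
      StrictlyUnitaryPseudofunctor.mapId_eq_eqToIso]
    ext X
    exact id_naturality_inv (F := F.1) _
  naturality_comp α β := by
    rw [StrictPseudofunctor.mapComp_eq_eqToIso, StrictPseudofunctor.mapComp_eq_eqToIso]
    ext X
    exact comp_naturality_inv α.hom β.hom _

/-- Equivalences are detected on components twice: first at each 2-functor `F`, then at each object
`X`, where the component is the image under `F` of an arrow already inverted in the homotopy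
2-category. -/
theorem isEquiv_precomposeHoToId {t : a ⟶ 𝟭 A} (ht : ∀ X, W (t.app X)) :
    IsEquiv (precomposeHoToId hW hT D ha t) :=
  isEquiv_of_app fun F => isEquiv_of_hom (isEquiv_of_app fun X =>
    IsEquiv.map (HomP.toStrict F) (hT (t.app X.as).toLoc (ht X.as)))

theorem isEquiv_precomposeHoToUnitTarget {t : a ⟶ j ⋙ p} (ht : ∀ X, W (t.app X)) :
    IsEquiv (precomposeHoToUnitTarget hW hT D ha hp hj t) :=
  isEquiv_of_app fun F => isEquiv_of_hom (isEquiv_of_app fun X =>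
    IsEquiv.map (HomP.toStrict F) (hT (t.app X.as).toLoc (ht X.as)))

theorem isEquiv_precomposeCToId {t : b ⟶ 𝟭 C} (ht : ∀ X, S (t.app X)) :
    IsEquiv (precomposeCToId D hb t) :=
  isEquiv_of_app fun F => isEquiv_of_hom (isEquiv_of_app fun X =>
    F.2 (t.app X.as).toLoc (ht X.as))

theorem isEquiv_precomposeCToCounitSource {t : b ⟶ p ⋙ j} (ht : ∀ X, S (t.app X)) :
    IsEquiv (precomposeCToCounitSource hW hT D hp hj hb t) :=
  isEquiv_of_app fun F => isEquiv_of_hom (isEquiv_of_app fun X =>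
    F.2 (t.app X.as).toLoc (ht X.as))

-- The formal half of the theorem. No model structure enters: it suffices that the inclusions invert
-- `W`, that the functors preserve the classes, and that both zigzags exist.
include hW hj ha hb in
theorem isPseudoequivalence_precompose_toHo {t : a ⟶ 𝟭 A} (ht : ∀ X, W (t.app X))
    {s : a ⟶ j ⋙ p} (hs : ∀ X, W (s.app X)) {t' : b ⟶ 𝟭 C} (ht' : ∀ X, S (t'.app X))
    {s' : b ⟶ p ⋙ j} (hs' : ∀ X, S (s'.app X)) :
    IsPseudoequivalence (precompose (S := toLoc S) (toHo p) (inverts_toHo hT hp) D) := by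
  refine ⟨restrictExtend hW hT D hj, ?_, ?_⟩
  -- The unit starts at the identity, so the leg ending there is inverted.
  · obtain ⟨k, hk⟩ := (isEquiv_precomposeHoToId hW hT D ha ht).exists_inverse
    exact ⟨InducedBicategory.mkHom (k ≫ precomposeHoToUnitTarget hW hT D ha hp hj s),
      isEquiv_of_hom (hk.comp (isEquiv_precomposeHoToUnitTarget hW hT D ha hp hj hs))⟩
  -- The counit ends at the identity, so here the other leg is inverted.
  · obtain ⟨k, hk⟩ := (isEquiv_precomposeCToCounitSource hW hT D hp hj hb hs').exists_inverse
    exact ⟨InducedBicategory.mkHom (k ≫ precomposeCToId D hb t'),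
      isEquiv_of_hom (hk.comp (isEquiv_precomposeCToId D hb ht'))⟩

end Zigzag

/-! ### Invertibility of the 2-cells given by homotopies. -/

section InverseHomotopy

variable {A : Type u} [Category.{v} A] {W : MorphismProperty A}

/-- The cylinder obtained by exchanging `d₀` and `d₁`. -/
def Cylinder.symm {X : A} (C : Cylinder W X) : Cylinder W X :=
  ⟨C.cyl, C.base, C.d₁, C.d₀, C.s, C.x, C.hs, C.fac₁, C.fac₀⟩

/-- The inverse homotopy. -/
def Homotopy.symm {X Y : A} {f g : X ⟶ Y} (H : Homotopy W f g) : Homotopy W g f :=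
  ⟨H.C.symm, H.h, H.fac₁, H.fac₀⟩

section Hat

variable {D : Type u'} [Bicategory.{w', v'} D] (F : StrictPseudofunctor (LocallyDiscrete A) D)
  (hF : Inverts F (toLoc W))

/-- The 2-cell associated to the symmetric cylinder. -/
noncomputable def hatCylinderSymm {X : A} (C : Cylinder W X) :
    onArrow F C.d₁ ⟶ onArrow F C.d₀ :=
  hatCylinder F hF C.symm

theorem hatCylinderSymm_spec {X : A} (C : Cylinder W X) :
    hatCylinderSymm F hF C ▷ onArrow F C.s =
      eqToHom ((onArrow_eq F C.fac₁).trans (onArrow_eq F C.fac₀).symm) :=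
  hatCylinder_spec F hF C.symm

theorem hat_symm_eq {X Y : A} {f g : X ⟶ Y} (H : Homotopy W f g) :
    hat F hF H.symm = eqToHom (onArrow_eq F H.fac₁).symm ≫
      hatCylinderSymm F hF H.C ▷ onArrow F H.h ≫ eqToHom (onArrow_eq F H.fac₀) := rfl

/-- After whiskering with `F s` both factors come from equalities, and their composite is an
identity; whiskering with `F s` is faithful. -/
theorem hatCylinder_symm {X : A} (C : Cylinder W X) :
    hatCylinder F hF C ≫ hatCylinderSymm F hF C = 𝟙 _ := by
  apply IsEquiv.whiskerRight_injective (s := onArrow F C.s) (hF C.s.toLoc C.hs)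
  rw [comp_whiskerRight, hatCylinder_spec, hatCylinderSymm_spec, id_whiskerRight, eqToHom_trans,
    eqToHom_refl]

theorem hat_symm {X Y : A} {f g : X ⟶ Y} (H : Homotopy W f g) :
    hat F hF H ≫ hat F hF H.symm = 𝟙 _ := by
  have h := congrArg (fun x => x ▷ onArrow F H.h) (hatCylinder_symm F hF H.C)
  simp only [comp_whiskerRight, id_whiskerRight] at h
  rw [hat_symm_eq, hat]
  simp [reassoc_of% h]

end Hat

namespace HoCat

variable (T : Set (InvertingFunctor.{w', v', u'} W))

theorem mk₂_symm {X Y : A} {f g : X ⟶ Y} (H : Homotopy W f g) :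
    mk₂ T H.seq ≫ mk₂ T H.symm.seq = 𝟙 _ := by
  apply hom₂_ext
  intro P hP
  rw [ev_comp, ev_mk₂, ev_mk₂]
  simp only [Homotopy.seq, hatSeq, Category.comp_id]
  exact hat_symm _ _ _

/-- The invertible 2-cell represented by a homotopy. -/
def iso₂ {X Y : A} {f g : X ⟶ Y} (H : Homotopy W f g) :
    onArrow (incl T) f ≅ onArrow (incl T) g where
  hom := mk₂ T H.seq
  inv := mk₂ T H.symm.seq
  hom_inv_id := mk₂_symm T H
  inv_hom_id := mk₂_symm T H.symm

theorem isEquiv_incl_map {X Y : A} {f : X ⟶ Y} {g : Y ⟶ X}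
    (H : Homotopy W (f ≫ g) (𝟙 X)) (K : Homotopy W (g ≫ f) (𝟙 Y)) :
    IsEquiv ((incl T).map f.toLoc) :=
  ⟨(incl T).map g.toLoc, ⟨(iso₂ T H).symm⟩, ⟨iso₂ T K⟩⟩

end HoCat

end InverseHomotopy

/-! ### Bifibrant objects: Whitehead's theorem and the replacement functors. -/

section ModelCategory

variable {C : Type u} [Category.{v} C] [ModelCategory C]

/-- A homotopy in the present sense must stay among bifibrant objects. A very good cylinder does: it
is cofibrant because the two ends include by a cofibration from a cofibrant coproduct, and fibrant
because its projection is a fibration to a fibrant object. -/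
theorem nonempty_homotopy {X Y : BifibrantObject C} {f g : X ⟶ Y}
    (h : LeftHomotopyRel f.hom g.hom) : Nonempty (Homotopy (Wfc C) f g) := by
  obtain ⟨P, hP⟩ := HomotopicalAlgebra.Cylinder.exists_very_good X.obj
  have H := h.leftHomotopy P
  have hI : bifibrantObjects C P.I := ⟨inferInstanceAs (IsCofibrant P.I),
    inferInstanceAs (IsFibrant P.I)⟩
  exact ⟨{ C :=
            { cyl := ⟨P.I, hI⟩
              base := X
              d₀ := ObjectProperty.homMk P.i₀
              d₁ := ObjectProperty.homMk P.i₁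
              s := ObjectProperty.homMk P.π
              x := 𝟙 X
              hs := (weakEquivalence_iff P.π).1 inferInstance
              fac₀ := by ext; exact P.i₀_π
              fac₁ := by ext; exact P.i₁_π }
           h := ObjectProperty.homMk H.h
           fac₀ := by ext; exact H.h₀
           fac₁ := by ext; exact H.h₁ }⟩

/-- The homotopy inverse supplied by Whitehead's theorem does not depend on `T`. This uniformity is
what permits the one-element test sets of the size reduction. -/
theorem inverts_incl_bifibrant (T : Set (InvertingFunctor.{w', v', u'} (Wfc C))) :
    Inverts (HoCat.incl T) (toLoc (Wfc C)) := by
  rintro ⟨X⟩ ⟨Y⟩ ⟨f⟩ hf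
  have : WeakEquivalence f.hom := (weakEquivalence_iff _).2 hf
  obtain ⟨g, h₁, h₂⟩ := LeftHomotopyClass.whitehead f.hom
  obtain ⟨H⟩ := nonempty_homotopy (f := f ≫ ObjectProperty.homMk g) (g := 𝟙 X) h₁
  obtain ⟨K⟩ := nonempty_homotopy (f := ObjectProperty.homMk g ≫ f) (g := 𝟙 Y) h₂
  exact HoCat.isEquiv_incl_map T H K

variable (fac₁ : MorphismProperty.FunctorialFactorizationData (cofibrations C)
    (trivialFibrations C))
  (fac₂ : MorphismProperty.FunctorialFactorizationData (trivialCofibrations C) (fibrations C))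

/-- The natural trivial fibration from the cofibrant replacement. -/
noncomputable def pQ : Q fac₁ ⟶ 𝟭 C where
  app X := fac₁.p.app (Arrow.mk (initial.to X))
  naturality X Y f := fac₁.p.naturality
    (Arrow.homMk (𝟙 _) f : Arrow.mk (initial.to X) ⟶ Arrow.mk (initial.to Y))

/-- The natural trivial cofibration to the fibrant replacement. -/
noncomputable def iR : 𝟭 C ⟶ R fac₂ where
  app X := fac₂.i.app (Arrow.mk (terminal.from X))
  naturality X Y f := fac₂.i.naturality
    (Arrow.homMk f (𝟙 _) : Arrow.mk (terminal.from X) ⟶ Arrow.mk (terminal.from Y))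

instance (X : C) : WeakEquivalence ((pQ fac₁).app X) :=
  (weakEquivalence_iff (fac₁.p.app (Arrow.mk (initial.to X)))).2 (fac₁.hp _).2

instance (X : C) : Fibration ((pQ fac₁).app X) :=
  (fibration_iff (fac₁.p.app (Arrow.mk (initial.to X)))).2 (fac₁.hp _).1

instance (X : C) : WeakEquivalence ((iR fac₂).app X) :=
  (weakEquivalence_iff (fac₂.i.app (Arrow.mk (terminal.from X)))).2 (fac₂.hi _).2

theorem weakEquivalence_Q_map {X Y : C} (f : X ⟶ Y) [WeakEquivalence f] :
    WeakEquivalence ((Q fac₁).map f) :=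
  have : WeakEquivalence ((𝟭 C).map f) := ‹_›
  weakEquivalence_of_postcomp_of_fac ((pQ fac₁).naturality f)

theorem weakEquivalence_R_map {X Y : C} (f : X ⟶ Y) [WeakEquivalence f] :
    WeakEquivalence ((R fac₂).map f) :=
  have : WeakEquivalence ((𝟭 C).map f) := ‹_›
  weakEquivalence_of_precomp_of_fac ((iR fac₂).naturality f).symm

/-- `Q X` is fibrant since it maps to the fibrant `X` by a fibration. Hence `Q` alone restricts to
bifibrant objects and can be the middle of the zigzag there. -/
theorem isBifibrant_Q (X : BifibrantObject C) :
    bifibrantObjects C ((BifibrantObject.ι ⋙ Q fac₁).obj X) :=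
  ⟨(isCofibrant_iff_of_isInitial (fac₁.i.app (Arrow.mk (initial.to X.obj))) initialIsInitial).2
      ((cofibration_iff _).2 (fac₁.hi _)),
    have : IsFibrant ((𝟭 C).obj X.obj) := X.property.2
    isFibrant_of_fibration ((pQ fac₁).app X.obj)⟩

/-- The cofibrant replacement of fibrant-cofibrant objects. -/
noncomputable def bifibrantQ : BifibrantObject C ⥤ BifibrantObject C :=
  (bifibrantObjects C).lift (BifibrantObject.ι ⋙ Q fac₁) (isBifibrant_Q fac₁)

end ModelCategory

end TwoLoc

theorem mainTheorem1 {C : Type u} [Category.{v} C] [ModelCategory C]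
    (fac₁ : MorphismProperty.FunctorialFactorizationData
      (cofibrations C) (trivialFibrations C))
    (fac₂ : MorphismProperty.FunctorialFactorizationData
      (trivialCofibrations C) (fibrations C)) :
    TwoLoc.Is2Localization.{v, max u v, v, v, u, u, w', v', u'} (TwoLoc.toLoc (weakEquivalences C))
      (TwoLoc.q fac₁ fac₂) := by
  have hp : ∀ ⦃X Y : C⦄ (f : X ⟶ Y), weakEquivalences C f →
      TwoLoc.Wfc C ((TwoLoc.r fac₁ fac₂).map f) := fun X Y f hf => by
    have : WeakEquivalence f := (weakEquivalence_iff _).2 hf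
    have := TwoLoc.weakEquivalence_Q_map fac₁ f
    exact (weakEquivalence_iff _).1 (TwoLoc.weakEquivalence_R_map fac₂ ((TwoLoc.Q fac₁).map f))
  have hb : ∀ ⦃X Y : C⦄ (f : X ⟶ Y), weakEquivalences C f →
      weakEquivalences C ((TwoLoc.Q fac₁).map f) := fun X Y f hf => by
    have : WeakEquivalence f := (weakEquivalence_iff _).2 hf
    exact (weakEquivalence_iff _).1 (TwoLoc.weakEquivalence_Q_map fac₁ f)
  refine ⟨TwoLoc.inverts_toHo (TwoLoc.inverts_incl_bifibrant _) hp, fun D _ _ => ?_⟩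
  -- Both zigzags have `Q` in the middle. The legs to the identity are the trivial fibrations `pQ`;
  -- the legs to `RQ` are the trivial cofibrations `iR` at `Q X`.
  exact TwoLoc.isPseudoequivalence_precompose_toHo (a := TwoLoc.bifibrantQ fac₁)
    (b := TwoLoc.Q fac₁) (j := BifibrantObject.ι) TwoLoc.inverts_incl_bifibrant
    (TwoLoc.inverts_incl_bifibrant _) D (fun X Y f hf => hb f.hom hf) hp (fun _ _ _ hf => hf) hb
    (t :=
      { app := fun X => ObjectProperty.homMk ((TwoLoc.pQ fac₁).app X.obj)
        naturality := fun _ _ f => by ext; exact (TwoLoc.pQ fac₁).naturality f.hom })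
    (fun X => (weakEquivalence_iff ((TwoLoc.pQ fac₁).app X.obj)).1 inferInstance)
    (s :=
      { app := fun X => ObjectProperty.homMk ((TwoLoc.iR fac₂).app ((TwoLoc.Q fac₁).obj X.obj))
        naturality := fun _ _ f => by
          ext; exact (TwoLoc.iR fac₂).naturality ((TwoLoc.Q fac₁).map f.hom) })
    (fun X => (weakEquivalence_iff ((TwoLoc.iR fac₂).app ((TwoLoc.Q fac₁).obj X.obj))).1
      inferInstance)
    (t' := TwoLoc.pQ fac₁) (fun X => (weakEquivalence_iff _).1 inferInstance)
    (s' :=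
      { app := fun X => (TwoLoc.iR fac₂).app ((TwoLoc.Q fac₁).obj X)
        naturality := fun _ _ f => (TwoLoc.iR fac₂).naturality ((TwoLoc.Q fac₁).map f) })
    (fun X => (weakEquivalence_iff ((TwoLoc.iR fac₂).app ((TwoLoc.Q fac₁).obj X))).1 inferInstance)
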